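/- Let $K$ be a field. A graded filtered Floer--Novikov complex $\mathfrak c=(\pi\colon P\to S,\mathcal A,\omega,gr,deg,\partial)$ over $K$ consists of: a principal $\Gamma$-bundle $\pi\colon P\to S$ (a surjection whose fibres are the orbits of a free action of $\Gamma$ on $P$), where $\Gamma$ is a finitely generated abelian group and $S$ is a finite set; functions $\mathcal A\colon P\to\mathbb R$, $gr\colon P\to\mathbb Z$ and homomorphisms $\omega\colon\Gamma\to\mathbb R$, $deg\colon\Gamma\to\mathbb Z$ with $\mathcal A(g\cdot p)=\mathcal A(p)-\omega(g)$ and $gr(g\cdot p)=gr(p)-deg(g)$; and a boundary operator $\partial$ as follows. Let $C_k=C_k(\mathfrak c)$ be the space of formal sums $\sum_{gr(p)=k}a_p\,p$ with $a_p\in K$ such that $\{p : a_p\ne0,\ \mathcal A(p)>C\}$ is finite for every $C\in\mathbb R$, let $C_*=\bigoplus_k C_k$, and let $\bar\Lambda$ be the Novikov ring of formal sums $\sum_{g\in\Gamma}b_g\,g$, $b_g\in K$, that involve only finitely many values of $deg$ and for which $\{g : b_g\neq0,\ \omega(g)<C\}$ is finite for every $C\in\mathbb R$; it acts on $C_*$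 by extending the action of $\Gamma$ on $P$. Put $\ell(\sum a_p\,p)=\max\{\mathcal A(p) : a_p\ne 0\}$ and $\ell(0)=-\infty$. Then $\partial\colon C_*\to C_*$ is a $\bar\Lambda$-module endomorphism with $\partial^2=0$, $\partial(C_k)\subset C_{k-1}$, and $\ell(\partial c)<\ell(c)$ for all $c\neq0$. Write $\partial p=\sum_q n(p,q)\,q$. The opposite complex $\mathfrak c^{op}$ has the same $\pi$, $\omega$ and $deg$, the action $g\cdot^{op}p=g^{-1}\cdot p$, $\mathcal A^{op}=-\mathcal A$, $gr^{op}=-gr$, and the boundary operator $\delta$ with $\delta p=\sum_q n(q,p)\,q$, that is, $\delta\big(\sum_p d_p\,p\big)=\sum_q\big(\sum_p d_p\,n(q,p)\big)\,q$; it is again a graded filtered Floer--Novikov complex. Let $D_*=C_*(\mathfrak c^{op})$, let $\ell^{op}$ be its filtration level, and define $\Delta\colon D_*\times C_*\to K$ by $\Delta(\sum d_p\,p,\sum c_q\,q)=\sum_p d_pc_p$. For $k\in\mathbb Z$ the linking form $\lambda\colon\delta(D_{-k+1})\times\partial(C_k)\to K$ is $\lambda(x,y)=\Delta(x,c)$ for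 any $c\in C_k$ with $\partial c=y$; this does not depend on the choice of $c$. The boundary depth is $$\beta_k(\mathfrak c)=\inf\Big\{\beta\in[0,\infty) : \forall\gamma\in\mathbb R,\ \partial(C_{k+1})\cap\{c\in C_k : \ell(c)<\gamma\}\subset\partial\big(\{c\in C_{k+1} : \ell(c)<\gamma+\beta\}\big)\Big\}.$$ Assume that $\omega$ is injective on $\ker(deg)$. Then for every $k\in\mathbb Z$ the boundary depth $\beta_{k-1}(\mathfrak c)$ is finite, and $$\beta_{k-1}(\mathfrak c)=\beta_{-k}(\mathfrak c^{op})=-\inf\big(\{0\}\cup\{\ell(y)+\ell^{op}(x) : x\in\delta(D_{-k+1}),\ y\in\partial(C_k),\ \lambda(x,y)\neq0\}\big).$$ -/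

import Mathlib

namespace FloerNovikov

open Classical in
/-- The function `P → K` which is `1` at `p` and `0` elsewhere. -/
noncomputable def indicatorOne {K X : Type*} [Field K] (x : X) : X → K :=
  fun y => if y = x then 1 else 0

/-- The geometric part of a graded filtered Floer-Novikov complex: a principal `Γ`-bundle
`proj : P → S` (the left action of `g` on `P` is the permutation `act g`), the action functional
`A`, the period homomorphism `ω`, the grading `gr` and the degree homomorphism `deg`. -/
structure Base (Γ P S : Type*) [CommGroup Γ] where
  proj : P → S
  act : Γ →* Equiv.Perm P
  proj_surjective : Function.Surjective proj
  proj_eq_iff : ∀ p q : P, proj p = proj q ↔ ∃ g : Γ, act g p = q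
  act_free : ∀ (g : Γ) (p : P), act g p = p → g = 1
  A : P → ℝ
  ω : Γ →* Multiplicative ℝ
  A_act : ∀ (g : Γ) (p : P), A (act g p) = A p - (ω g).toAdd
  gr : P → ℤ
  deg : Γ →* Multiplicative ℤ
  gr_act : ∀ (g : Γ) (p : P), gr (act g p) = gr p - (deg g).toAdd

theorem exists_ne_zero_of_finsum {K X : Type*} [Field K] {f : X → K} (h : ∑ᶠ x, f x ≠ 0) :
    ∃ x, f x ≠ 0 := by
  by_contra! h'
  exact h (by simp [h'])

theorem finsum_swap {K X Y : Type*} [Field K] (f : X → Y → K)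
    (h : {z : X × Y | f z.1 z.2 ≠ 0}.Finite) :
    ∑ᶠ x, ∑ᶠ y, f x y = ∑ᶠ y, ∑ᶠ x, f x y := by
  classical
  have hX := h.image Prod.fst
  have hY := h.image Prod.snd
  have h1 : ∀ x, ∑ᶠ y, f x y = ∑ y ∈ hY.toFinset, f x y := fun x =>
    finsum_eq_sum_of_support_subset _ fun y hy => by
      simpa using ⟨x, hy⟩
  have h2 : ∀ y, ∑ᶠ x, f x y = ∑ x ∈ hX.toFinset, f x y := fun y =>
    finsum_eq_sum_of_support_subset _ fun x hx => by
      simpa using ⟨y, hx⟩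
  rw [finsum_eq_sum_of_support_subset (s := hX.toFinset),
    finsum_eq_sum_of_support_subset (s := hY.toFinset)]
  · simp_rw [h1, h2]
    exact Finset.sum_comm
  · intro y hy
    obtain ⟨x, hx⟩ := exists_ne_zero_of_finsum hy
    simpa using ⟨x, hx⟩
  · intro x hx
    obtain ⟨y, hy⟩ := exists_ne_zero_of_finsum hx
    simpa using ⟨y, hy⟩

namespace Base

variable {K Γ P S : Type*} [Field K] [CommGroup Γ]

/-- The Floer chain complex `C_* = ⨁ₖ C_k` as a space of functions on `P`: the function `a` stands
for the formal sum `∑ a_p p`.  Only finitely many degrees occur, and above each action level there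
are only finitely many `p` with `a_p ≠ 0`. -/
def chains (B : Base Γ P S) (K : Type*) [Field K] : Submodule K (P → K) where
  carrier := {a | (∀ C : ℝ, {p | a p ≠ 0 ∧ C < B.A p}.Finite) ∧ (B.gr '' {p | a p ≠ 0}).Finite}
  zero_mem' := by simp
  add_mem' := by
    intro a b ha hb
    have key : ∀ p, (a + b) p ≠ 0 → a p ≠ 0 ∨ b p ≠ 0 := by
      intro p hp
      by_contra! h
      exact hp (by simp [h.1, h.2])
    refine ⟨fun C => ((ha.1 C).union (hb.1 C)).subset ?_, (ha.2.union hb.2).subset ?_⟩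
    · rintro p ⟨hp, hC⟩
      exact (key p hp).imp (fun h => ⟨h, hC⟩) (fun h => ⟨h, hC⟩)
    · rintro _ ⟨p, hp, rfl⟩
      exact (key p hp).imp (fun h => ⟨p, h, rfl⟩) (fun h => ⟨p, h, rfl⟩)
  smul_mem' := by
    intro t a ha
    have key : ∀ p, (t • a) p ≠ 0 → a p ≠ 0 := fun p hp h => hp (by simp [h])
    refine ⟨fun C => (ha.1 C).subset fun p hp => ⟨key p hp.1, hp.2⟩, ha.2.subset ?_⟩
    rintro _ ⟨p, hp, rfl⟩
    exact ⟨p, key p hp, rfl⟩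

/-- The degree `k` part `C_k` of `C_*`. -/
def chainsDeg (B : Base Γ P S) (K : Type*) [Field K] (k : ℤ) : Submodule K (B.chains K) where
  carrier := {a | ∀ p, a.1 p ≠ 0 → B.gr p = k}
  zero_mem' := by simp
  add_mem' := by
    intro a b ha hb p hp
    by_cases h : a.1 p = 0
    · exact hb p fun h' => hp (by simp [h, h'])
    · exact ha p h
  smul_mem' := by
    intro t a ha p hp
    exact ha p fun h => hp (by simp [h])

/-- `C_*` is the direct sum of the `C_k`. -/
theorem isInternal_chainsDeg (B : Base Γ P S) (K : Type*) [Field K] :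
    DirectSum.IsInternal fun k => B.chainsDeg K k := by
  classical
  rw [DirectSum.isInternal_submodule_iff_iSupIndep_and_iSup_eq_top]
  constructor
  · rw [iSupIndep_def]
    intro k
    rw [Submodule.disjoint_def]
    intro a ha ha'
    let Z : Submodule K (B.chains K) :=
      { carrier := {a | ∀ p, B.gr p = k → a.1 p = 0}
        zero_mem' := fun _ _ => rfl
        add_mem' := fun {x y} hx hy p hp => by
          change x.1 p + y.1 p = 0
          rw [hx p hp, hy p hp, add_zero]
        smul_mem' := fun t x hx p hp => by
          change t * x.1 p = 0
          rw [hx p hp, mul_zero] }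
    have hZ : (⨆ j, ⨆ (_ : j ≠ k), B.chainsDeg K j) ≤ Z := by
      refine iSup₂_le fun j hj x hx p hp => ?_
      by_contra hne
      exact hj ((hx p hne).symm.trans hp)
    refine Subtype.ext (funext fun p => ?_)
    by_contra hne
    exact hne (hZ ha' p (ha p hne))
  · rw [eq_top_iff]
    intro a _
    let part : ℤ → B.chains K := fun k => ⟨fun p => if B.gr p = k then a.1 p else 0, by
      have h : ∀ p, (if B.gr p = k then a.1 p else 0) ≠ 0 → a.1 p ≠ 0 := by
        intro p hp h0
        simp [h0] at hp
      refine ⟨fun C => (a.2.1 C).subset fun p hp => ⟨h p hp.1, hp.2⟩, a.2.2.subset ?_⟩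
      rintro _ ⟨p, hp, rfl⟩
      exact ⟨p, h p hp, rfl⟩⟩
    have hsum : a = ∑ k ∈ a.2.2.toFinset, part k := by
      refine Subtype.ext (funext fun p => ?_)
      rw [AddSubmonoidClass.coe_finsetSum, Finset.sum_apply]
      change _ = ∑ k ∈ a.2.2.toFinset, if B.gr p = k then a.1 p else 0
      rw [Finset.sum_ite_eq]
      split_ifs with hp
      · rfl
      · by_contra hne
        exact hp (a.2.2.mem_toFinset.2 ⟨p, hne, rfl⟩)
    rw [hsum]
    refine Submodule.sum_mem _ fun k _ => Submodule.mem_iSup_of_mem k fun p hp => ?_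
    by_contra hne
    exact hp (if_neg hne)

/-- The filtration level `ℓ (∑ a_p p) = max {A p | a_p ≠ 0}`, with `ℓ 0 = ⊥`. -/
noncomputable def level (B : Base Γ P S) (a : B.chains K) : EReal :=
  ⨆ (p : P) (_ : a.1 p ≠ 0), (B.A p : EReal)

/-- The subspace `C_k^{(-∞, α)}` of chains of degree `k` and filtration level less than `α`,
as a set. -/
def filtered (B : Base Γ P S) (K : Type*) [Field K] (k : ℤ) (α : ℝ) : Set (B.chains K) :=
  {a | a ∈ B.chainsDeg K k ∧ B.level a < (α : EReal)}

/-- The full Novikov ring `Λ̄ = ⨁ₙ eⁿ Λ`, as a space of functions on `Γ`: the function `b` stands for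
the formal sum `∑ b_g g`. Only finitely many degrees occur, and below each period there are
only finitely many `g` with `b_g ≠ 0`. -/
def novikov (B : Base Γ P S) (K : Type*) [Field K] : Submodule K (Γ → K) where
  carrier := {b | (∀ C : ℝ, {g | b g ≠ 0 ∧ (B.ω g).toAdd < C}.Finite) ∧
    ((fun g => (B.deg g).toAdd) '' {g | b g ≠ 0}).Finite}
  zero_mem' := by simp
  add_mem' := by
    intro a b ha hb
    have key : ∀ p, (a + b) p ≠ 0 → a p ≠ 0 ∨ b p ≠ 0 := by
      intro p hp
      by_contra! h
      exact hp (by simp [h.1, h.2])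
    refine ⟨fun C => ((ha.1 C).union (hb.1 C)).subset ?_, (ha.2.union hb.2).subset ?_⟩
    · rintro p ⟨hp, hC⟩
      exact (key p hp).imp (fun h => ⟨h, hC⟩) (fun h => ⟨h, hC⟩)
    · rintro _ ⟨p, hp, rfl⟩
      exact (key p hp).imp (fun h => ⟨p, h, rfl⟩) (fun h => ⟨p, h, rfl⟩)
  smul_mem' := by
    intro t a ha
    have key : ∀ p, (t • a) p ≠ 0 → a p ≠ 0 := fun p hp h => hp (by simp [h])
    refine ⟨fun C => (ha.1 C).subset fun p hp => ⟨key p hp.1, hp.2⟩, ha.2.subset ?_⟩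
    rintro _ ⟨p, hp, rfl⟩
    exact ⟨p, key p hp, rfl⟩

theorem bddAbove_of_mem (B : Base Γ P S) {a : P → K} (ha : a ∈ B.chains K) :
    ∃ M : ℝ, ∀ p, a p ≠ 0 → B.A p ≤ M := by
  obtain ⟨M, hM⟩ := ((ha.1 0).image B.A).bddAbove
  refine ⟨max M 0, fun p hp => ?_⟩
  by_cases h : 0 < B.A p
  · exact le_max_of_le_left (hM ⟨p, ⟨hp, h⟩, rfl⟩)
  · exact le_max_of_le_right (not_lt.mp h)

theorem bddBelow_of_mem (B : Base Γ P S) {b : Γ → K} (hb : b ∈ B.novikov K) :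
    ∃ m : ℝ, ∀ g, b g ≠ 0 → m ≤ (B.ω g).toAdd := by
  obtain ⟨M, hM⟩ := ((hb.1 0).image fun g => (B.ω g).toAdd).bddBelow
  refine ⟨min M 0, fun p hp => ?_⟩
  by_cases h : (B.ω p).toAdd < 0
  · exact min_le_of_left_le (hM ⟨p, ⟨hp, h⟩, rfl⟩)
  · exact min_le_of_right_le (not_lt.mp h)

theorem act_inv_act (B : Base Γ P S) (g : Γ) (p : P) : B.act g⁻¹ (B.act g p) = p := by
  rw [← Equiv.Perm.mul_apply, ← map_mul]; simp

theorem act_act_inv (B : Base Γ P S) (g : Γ) (p : P) : B.act g (B.act g⁻¹ p) = p := by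
  rw [← Equiv.Perm.mul_apply, ← map_mul]; simp

/-- The action `(∑ b_g g) · (∑ a_q q) = ∑ b_g a_q (g · q)` of `Λ̄` on `C_*`: the coefficient at `p`
is the (finite) sum of `b_g a_{g⁻¹ · p}` over `g`. -/
noncomputable def conv (B : Base Γ P S) (b : Γ → K) (a : P → K) : P → K :=
  fun p => ∑ᶠ g, b g * a (B.act g⁻¹ p)

theorem conv_mem (B : Base Γ P S) {b : Γ → K} {a : P → K} (hb : b ∈ B.novikov K)
    (ha : a ∈ B.chains K) : B.conv b a ∈ B.chains K := by
  have key : ∀ p, B.conv b a p ≠ 0 → ∃ g q, b g ≠ 0 ∧ a q ≠ 0 ∧ p = B.act g q := by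
    intro p hp
    obtain ⟨g, hg⟩ := exists_ne_zero_of_finsum hp
    exact ⟨g, B.act g⁻¹ p, left_ne_zero_of_mul hg, right_ne_zero_of_mul hg,
      (B.act_act_inv g p).symm⟩
  obtain ⟨M, hM⟩ := B.bddAbove_of_mem ha
  obtain ⟨m, hm⟩ := B.bddBelow_of_mem hb
  refine ⟨fun C => ?_, ?_⟩
  · refine (Set.Finite.image2 (fun g q => B.act g q) (hb.1 (M - C)) (ha.1 (C + m))).subset ?_
    rintro p ⟨hp, hC⟩
    obtain ⟨g, q, hg, hq, rfl⟩ := key p hp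
    rw [B.A_act] at hC
    have h1 := hM q hq
    have h2 := hm g hg
    exact ⟨g, ⟨hg, by linarith⟩, q, ⟨hq, by linarith⟩, rfl⟩
  · refine (Set.Finite.image2 (fun q g : ℤ => q - g) ha.2 hb.2).subset ?_
    rintro _ ⟨p, hp, rfl⟩
    obtain ⟨g, q, hg, hq, rfl⟩ := key p hp
    exact ⟨_, ⟨q, hq, rfl⟩, _, ⟨g, hg, rfl⟩, (B.gr_act g q).symm⟩

/-- The action of `Λ̄` on `C_*`. -/
noncomputable def novikovSMul (B : Base Γ P S) (b : B.novikov K) (a : B.chains K) : B.chains K :=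
  ⟨B.conv b.1 a.1, B.conv_mem b.2 a.2⟩

theorem indicatorOne_mem (B : Base Γ P S) (p : P) :
    (indicatorOne p : P → K) ∈ B.chains K := by
  have h : ∀ q, (indicatorOne p : P → K) q ≠ 0 → q = p := by
    intro q hq
    by_contra hne
    exact hq (by simp [indicatorOne, hne])
  refine ⟨fun C => (Set.finite_singleton p).subset fun q hq => h q hq.1,
    (Set.finite_singleton (B.gr p)).subset ?_⟩
  rintro _ ⟨q, hq, rfl⟩
  rw [h q hq]; rfl

/-- The generator `p` of `C_*`. -/
noncomputable def gen (B : Base Γ P S) (K : Type*) [Field K] (p : P) : B.chains K :=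
  ⟨indicatorOne p, B.indicatorOne_mem p⟩

/-- The opposite data: inverse action of `Γ`, negated action functional and grading,
the same `ω` and `deg`. -/
def op (B : Base Γ P S) : Base Γ P S where
  proj := B.proj
  act := B.act.comp invMonoidHom
  proj_surjective := B.proj_surjective
  proj_eq_iff p q := by
    rw [B.proj_eq_iff]
    constructor
    · rintro ⟨g, hg⟩
      exact ⟨g⁻¹, by simpa using hg⟩
    · rintro ⟨g, hg⟩
      exact ⟨g⁻¹, by simpa using hg⟩
  act_free g p h := by
    have := B.act_free g⁻¹ p h
    simpa using this
  A p := - B.A p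
  ω := B.ω
  A_act g p := by
    have := B.A_act g⁻¹ p
    rw [map_inv B.ω, toAdd_inv] at this
    change - B.A (B.act g⁻¹ p) = - B.A p - _
    rw [this]
    ring
  gr p := - B.gr p
  deg := B.deg
  gr_act g p := by
    have := B.gr_act g⁻¹ p
    rw [map_inv B.deg, toAdd_inv] at this
    change - B.gr (B.act g⁻¹ p) = - B.gr p - _
    rw [this]
    ring

/-- The pairing `Δ (∑ d_p p, ∑ c_q q) = ∑ d_p c_p` between the chains `D_*` of the opposite data
and `C_*`; the sum is finite by `pairing_finite`. -/
noncomputable def pairing (B : Base Γ P S) (d : B.op.chains K) (c : B.chains K) : K :=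
  ∑ᶠ p, d.1 p * c.1 p

theorem pairing_finite (B : Base Γ P S) {d c : P → K} (hd : d ∈ B.op.chains K)
    (hc : c ∈ B.chains K) : (Function.support fun p => d p * c p).Finite := by
  obtain ⟨M, hM⟩ := B.op.bddAbove_of_mem hd
  refine (hc.1 (- M - 1)).subset fun p hp => ⟨right_ne_zero_of_mul hp, ?_⟩
  have h : - B.A p ≤ M := hM p (left_ne_zero_of_mul hp)
  linarith

theorem pairing_add_left (B : Base Γ P S) (d d' : B.op.chains K) (c : B.chains K) :
    B.pairing (d + d') c = B.pairing d c + B.pairing d' c := by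
  unfold pairing
  rw [← finsum_add_distrib (B.pairing_finite d.2 c.2) (B.pairing_finite d'.2 c.2)]
  exact finsum_congr fun p => by simp [add_mul]

theorem pairing_smul_left (B : Base Γ P S) (t : K) (d : B.op.chains K) (c : B.chains K) :
    B.pairing (t • d) c = t * B.pairing d c := by
  unfold pairing
  rw [mul_finsum' _ _ (B.pairing_finite d.2 c.2)]
  exact finsum_congr fun p => by simp [mul_assoc]

theorem le_level (B : Base Γ P S) (a : B.chains K) {p : P} (hp : a.1 p ≠ 0) :
    (B.A p : EReal) ≤ B.level a :=
  le_iSup₂ (f := fun (p : P) (_ : a.1 p ≠ 0) => (B.A p : EReal)) p hp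

theorem level_le (B : Base Γ P S) (a : B.chains K) {C : EReal}
    (h : ∀ p, a.1 p ≠ 0 → (B.A p : EReal) ≤ C) : B.level a ≤ C :=
  iSup₂_le h

/-- The maximum in the definition of the level of a nonzero chain is attained. -/
theorem exists_level_eq (B : Base Γ P S) (a : B.chains K) (ha : a ≠ 0) :
    ∃ p, a.1 p ≠ 0 ∧ B.level a = B.A p := by
  obtain ⟨p₀, hp₀⟩ : ∃ p, a.1 p ≠ 0 := by
    by_contra! h
    exact ha (Subtype.ext (funext h))
  obtain ⟨p, hp, hmax⟩ := (a.2.1 (B.A p₀ - 1)).exists_maximalFor B.A _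
    ⟨p₀, hp₀, by linarith⟩
  refine ⟨p, hp.1, le_antisymm (B.level_le a fun q hq => ?_) (B.le_level a hp.1)⟩
  rw [EReal.coe_le_coe_iff]
  by_contra! hlt
  have h2 : q ∈ {p | a.1 p ≠ 0 ∧ B.A p₀ - 1 < B.A p} := ⟨hq, hp.2.trans hlt⟩
  exact absurd (hmax h2 hlt.le) (not_le.mpr hlt)

theorem gen_apply_ne (B : Base Γ P S) {p q : P} (h : (B.gen K p).1 q ≠ 0) : q = p := by
  by_contra hne
  exact h (by simp [gen, indicatorOne, hne])

theorem gen_apply_self (B : Base Γ P S) (p : P) : (B.gen K p).1 p = 1 := by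
  simp [gen, indicatorOne]

/-- An element of `Γ`, seen in the Novikov ring. -/
noncomputable def groupElt (B : Base Γ P S) (K : Type*) [Field K] (g : Γ) : B.novikov K := by
  refine ⟨indicatorOne g, fun C => (Set.finite_singleton g).subset ?_,
    (Set.finite_singleton (B.deg g).toAdd).subset ?_⟩
  · rintro h ⟨hh, -⟩
    by_contra hne
    exact hh (if_neg hne)
  · rintro _ ⟨h, hh, rfl⟩
    by_cases hne : h = g
    · rw [hne]; rfl
    · exact absurd (if_neg hne) hh

theorem groupElt_smul_apply (B : Base Γ P S) (g : Γ) (a : B.chains K) (p : P) :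
    (B.novikovSMul (B.groupElt K g) a).1 p = a.1 (B.act g⁻¹ p) := by
  change ∑ᶠ h, (indicatorOne g : Γ → K) h * a.1 (B.act h⁻¹ p) = _
  rw [finsum_eq_single _ g]
  · simp [indicatorOne]
  · intro h hne
    simp [indicatorOne, hne]

theorem groupElt_smul_gen (B : Base Γ P S) (g : Γ) (p : P) :
    B.novikovSMul (B.groupElt K g) (B.gen K p) = B.gen K (B.act g p) := by
  refine Subtype.ext (funext fun q => ?_)
  rw [groupElt_smul_apply]
  have h : B.act g⁻¹ q = p ↔ q = B.act g p := by
    constructor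
    · rintro rfl
      exact (B.act_act_inv g q).symm
    · rintro rfl
      exact B.act_inv_act g p
  simp only [gen, indicatorOne]
  by_cases hq : q = B.act g p
  · rw [if_pos hq, if_pos (h.2 hq)]
  · rw [if_neg hq, if_neg fun h' => hq (h.1 h')]

end Base

/-- A graded filtered Floer-Novikov complex over the field `K`: the boundary operator `bd` is a
`Λ̄`-module endomorphism of `C_*` (it is additive, in fact `K`-linear, and commutes with the action
of `Λ̄`) which squares to zero, strictly lowers the filtration level of nonzero chains and
has degree `-1`. -/
structure FloerNovikovComplex (K Γ P S : Type*) [Field K] [CommGroup Γ] [Group.FG Γ] [Finite S]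
    extends Base Γ P S where
  bd : toBase.chains K →ₗ[K] toBase.chains K
  bd_novikovSMul : ∀ (b : toBase.novikov K) (a : toBase.chains K),
    bd (toBase.novikovSMul b a) = toBase.novikovSMul b (bd a)
  bd_bd : ∀ a : toBase.chains K, bd (bd a) = 0
  level_bd_lt : ∀ a : toBase.chains K, a ≠ 0 → toBase.level (bd a) < toBase.level a
  bd_mem : ∀ (k : ℤ) (a : toBase.chains K), a ∈ toBase.chainsDeg K k →
    bd a ∈ toBase.chainsDeg K (k - 1)

namespace FloerNovikovComplex

variable {K Γ P S : Type*} [Field K] [CommGroup Γ] [Group.FG Γ] [Finite S]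

/-- The matrix of the boundary operator: `∂ p = ∑ n(p, q) q`. -/
noncomputable def n (c : FloerNovikovComplex K Γ P S) (p q : P) : K :=
  (c.bd (c.gen K p)).1 q

theorem A_lt_of_n (c : FloerNovikovComplex K Γ P S) {p q : P} (h : c.n p q ≠ 0) :
    c.A q < c.A p := by
  have hne : c.gen K p ≠ 0 := fun h0 => by
    have h1 := c.gen_apply_self (K := K) p
    rw [h0] at h1
    exact zero_ne_one h1
  have h1 := c.le_level (c.bd (c.gen K p)) h
  have h2 := c.level_le (c.gen K p) (C := (c.A p : EReal)) fun q hq => by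
    rw [c.gen_apply_ne hq]
  exact EReal.coe_lt_coe_iff.mp ((h1.trans_lt (c.level_bd_lt _ hne)).trans_le h2)

theorem gr_of_n (c : FloerNovikovComplex K Γ P S) {p q : P} (h : c.n p q ≠ 0) :
    c.gr q = c.gr p - 1 :=
  c.bd_mem (c.gr p) (c.gen K p) (fun q hq => by rw [c.gen_apply_ne hq]) q h

theorem n_act (c : FloerNovikovComplex K Γ P S) (g : Γ) (p q : P) :
    c.n (c.act g p) (c.act g q) = c.n p q := by
  unfold n
  rw [← c.groupElt_smul_gen, c.bd_novikovSMul, c.groupElt_smul_apply, c.act_inv_act]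

theorem bd_apply (c : FloerNovikovComplex K Γ P S) (a : c.chains K) (q : P) :
    (c.bd a).1 q = ∑ᶠ p, a.1 p * c.n p q := by
  classical
  set F := (a.2.1 (c.A q)).toFinset with hF
  have hmem : ∀ p, p ∈ F ↔ a.1 p ≠ 0 ∧ c.A q < c.A p := by simp [hF]
  set t : c.chains K := ∑ p ∈ F, a.1 p • c.gen K p with ht
  have ht_apply : ∀ x, t.1 x = if x ∈ F then a.1 x else 0 := by
    intro x
    have : t.1 x = ∑ p ∈ F, a.1 p * (if x = p then 1 else 0) := by
      rw [ht, AddSubmonoidClass.coe_finsetSum, Finset.sum_apply]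
      rfl
    rw [this]
    simp
  have hrest : (c.bd (a - t)).1 q = 0 := by
    by_contra hne
    have h0 : a - t ≠ 0 := by
      intro h0
      rw [h0, map_zero] at hne
      exact hne rfl
    have h1 := (c.le_level _ hne).trans_lt (c.level_bd_lt _ h0)
    have h2 : c.level (a - t) ≤ c.A q := c.level_le _ fun p hp => by
      rw [EReal.coe_le_coe_iff]
      by_contra! hlt
      have hval : (a - t).1 p = a.1 p - t.1 p := rfl
      rw [hval, ht_apply] at hp
      by_cases hpF : p ∈ F
      · simp [hpF] at hp
      · rw [if_neg hpF, sub_zero] at hp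
        exact hpF ((hmem p).2 ⟨hp, hlt⟩)
    exact absurd h1 (not_lt.mpr h2)
  have hsplit : (c.bd a).1 q = (c.bd t).1 q := by
    rw [map_sub] at hrest
    exact sub_eq_zero.mp hrest
  have htq : (c.bd t).1 q = ∑ p ∈ F, a.1 p * c.n p q := by
    rw [ht, map_sum, AddSubmonoidClass.coe_finsetSum, Finset.sum_apply]
    refine Finset.sum_congr rfl fun p _ => ?_
    rw [map_smul]; rfl
  rw [hsplit, htq, finsum_eq_sum_of_support_subset]
  intro p hp
  exact (hmem p).2 ⟨left_ne_zero_of_mul hp, c.A_lt_of_n (right_ne_zero_of_mul hp)⟩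

/-- The boundary operator `δ` of the opposite complex, given by `δ p = ∑ n(q, p) q`; that is,
`δ (∑ d_p p) = ∑_q (∑_p d_p n(q, p)) q`. -/
noncomputable def opBdFun (c : FloerNovikovComplex K Γ P S) (d : P → K) : P → K :=
  fun q => ∑ᶠ p, d p * c.n q p

theorem opBdFun_eq_pairing (c : FloerNovikovComplex K Γ P S) (d : c.op.chains K) (q : P) :
    c.opBdFun d.1 q = c.pairing d (c.bd (c.gen K q)) := rfl

theorem opBdFun_mem (c : FloerNovikovComplex K Γ P S) {d : P → K} (hd : d ∈ c.op.chains K) :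
    c.opBdFun d ∈ c.op.chains K := by
  have key : ∀ q, c.opBdFun d q ≠ 0 → ∃ p, d p ≠ 0 ∧ c.n q p ≠ 0 := by
    intro q hq
    obtain ⟨p, hp⟩ := exists_ne_zero_of_finsum hq
    exact ⟨p, left_ne_zero_of_mul hp, right_ne_zero_of_mul hp⟩
  refine ⟨fun C => ?_, ?_⟩
  · obtain ⟨rep, hrep⟩ := c.proj_surjective.hasRightInverse
    have hfin : ∀ p, {q | c.n q p ≠ 0 ∧ C < - c.A q}.Finite := by
      intro p
      have hs : ∀ s : S, {q | c.proj q = s ∧ c.n q p ≠ 0 ∧ C < - c.A q}.Finite := by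
        intro s
        have h1 := (c.bd (c.gen K (rep s))).2.1 (c.A p + c.A (rep s) + C)
        refine Set.Finite.of_finite_image
          (f := fun q => {r | ∃ g, c.act g (rep s) = q ∧ c.act g r = p})
          ((h1.image fun r => ({r} : Set P)).subset ?_) ?_
        · rintro _ ⟨q, ⟨hq, hn, hC⟩, rfl⟩
          obtain ⟨g, rfl⟩ := (c.proj_eq_iff (rep s) q).1 ((hrep s).trans hq.symm)
          refine ⟨c.act g⁻¹ p, ⟨?_, ?_⟩, ?_⟩
          · have := c.n_act g (rep s) (c.act g⁻¹ p)
            rw [c.act_act_inv] at this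
            change c.n (rep s) _ ≠ 0
            rwa [← this]
          · rw [c.A_act] at hC
            rw [c.A_act, map_inv, toAdd_inv]
            linarith
          · ext r
            simp only [Set.mem_singleton_iff, Set.mem_ofPred_eq]
            constructor
            · rintro rfl
              exact ⟨g, rfl, c.act_act_inv g p⟩
            · rintro ⟨g', h, rfl⟩
              have : g⁻¹ * g' = 1 := c.act_free _ (rep s) (by
                rw [map_mul, Equiv.Perm.mul_apply, h, c.act_inv_act])
              rw [inv_mul_eq_one.mp this, c.act_inv_act]
        · rintro q ⟨hq, -⟩ q' ⟨hq', -⟩ heq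
          obtain ⟨g, rfl⟩ := (c.proj_eq_iff (rep s) q).1 ((hrep s).trans hq.symm)
          obtain ⟨g', rfl⟩ := (c.proj_eq_iff (rep s) q').1 ((hrep s).trans hq'.symm)
          have h1 : c.act g⁻¹ p ∈ {r | ∃ h, c.act h (rep s) = c.act g' (rep s) ∧
              c.act h r = p} := by
            beta_reduce at heq
            rw [← heq]
            exact ⟨g, rfl, c.act_act_inv g p⟩
          obtain ⟨h, hh, hp⟩ := h1
          have h2 : g⁻¹ * h = 1 := by
            have h3 : h * g⁻¹ = 1 := c.act_free _ p (by
              rw [map_mul, Equiv.Perm.mul_apply, hp])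
            rwa [mul_comm]
          rw [inv_mul_eq_one.mp h2]
          exact hh
      refine (Set.finite_iUnion hs).subset fun q hq => ?_
      exact Set.mem_iUnion.2 ⟨c.proj q, rfl, hq.1, hq.2⟩
    refine ((hd.1 C).biUnion fun p _ => hfin p).subset ?_
    rintro q ⟨hq, hC⟩
    obtain ⟨p, hp, hn⟩ := key q hq
    have h1 := c.A_lt_of_n hn
    have h2 : C < - c.A q := hC
    exact Set.mem_biUnion (x := p) ⟨hp, show C < - c.A p by linarith⟩ ⟨hn, hC⟩
  · refine (hd.2.image fun k => k - 1).subset ?_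
    rintro _ ⟨q, hq, rfl⟩
    obtain ⟨p, hp, hn⟩ := key q hq
    refine ⟨_, ⟨p, hp, rfl⟩, ?_⟩
    have h1 := c.gr_of_n hn
    change - c.gr p - 1 = - c.gr q
    omega

noncomputable def opBd (c : FloerNovikovComplex K Γ P S) : c.op.chains K →ₗ[K] c.op.chains K where
  toFun d := ⟨c.opBdFun d.1, c.opBdFun_mem d.2⟩
  map_add' d d' := Subtype.ext (funext fun q => by
    change c.opBdFun (d + d').1 q = c.opBdFun d.1 q + c.opBdFun d'.1 q
    simp only [opBdFun_eq_pairing, c.pairing_add_left])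
  map_smul' t d := Subtype.ext (funext fun q => by
    change c.opBdFun (t • d).1 q = t * c.opBdFun d.1 q
    simp only [opBdFun_eq_pairing, c.pairing_smul_left])

/-- The adjunction relation `Δ (δ d, a) = Δ (d, ∂ a)`. -/
theorem pairing_opBd (c : FloerNovikovComplex K Γ P S) (d : c.op.chains K) (a : c.chains K) :
    c.pairing (c.opBd d) a = c.pairing d (c.bd a) := by
  change ∑ᶠ q, (∑ᶠ p, d.1 p * c.n q p) * a.1 q = ∑ᶠ p, d.1 p * (c.bd a).1 p
  have h1 : ∀ q, (∑ᶠ p, d.1 p * c.n q p) * a.1 q = ∑ᶠ p, d.1 p * c.n q p * a.1 q :=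
    fun q => finsum_mul _ _
  have h2 : ∀ p, d.1 p * (c.bd a).1 p = ∑ᶠ q, d.1 p * c.n q p * a.1 q := fun p => by
    rw [c.bd_apply, mul_finsum]
    exact finsum_congr fun q => by ring
  rw [finsum_congr h1, finsum_congr h2]
  refine finsum_swap _ ?_
  obtain ⟨M, hM⟩ := c.bddAbove_of_mem a.2
  obtain ⟨m, hm⟩ := c.op.bddAbove_of_mem d.2
  refine ((a.2.1 (-m)).prod (d.2.1 (-M))).subset ?_
  rintro ⟨q, p⟩ h
  have ha : a.1 q ≠ 0 := right_ne_zero_of_mul h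
  have hd : d.1 p ≠ 0 := left_ne_zero_of_mul (left_ne_zero_of_mul h)
  have hn : c.A p < c.A q := c.A_lt_of_n (right_ne_zero_of_mul (left_ne_zero_of_mul h))
  have h3 := hM q ha
  have h4 : - c.A p ≤ m := hm p hd
  exact ⟨⟨ha, by linarith⟩, hd, show -M < - c.A p by linarith⟩

/-- The opposite complex. -/
noncomputable abbrev opposite (c : FloerNovikovComplex K Γ P S) : FloerNovikovComplex K Γ P S where
  toBase := c.op
  bd := c.opBd
  bd_novikovSMul b d := by
    refine Subtype.ext (funext fun q => ?_)
    have hact : ∀ g p, c.op.act g⁻¹ p = c.act g p := fun g p => by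
      change c.act (g⁻¹)⁻¹ p = _
      rw [inv_inv]
    change ∑ᶠ p, (∑ᶠ g, b.1 g * d.1 (c.op.act g⁻¹ p)) * c.n q p =
      ∑ᶠ g, b.1 g * ∑ᶠ p, d.1 p * c.n (c.op.act g⁻¹ q) p
    simp only [hact]
    have h1 : ∀ p, (∑ᶠ g, b.1 g * d.1 (c.act g p)) * c.n q p =
        ∑ᶠ g, b.1 g * d.1 (c.act g p) * c.n q p := fun p => finsum_mul _ _
    have h2 : ∀ g, b.1 g * ∑ᶠ p, d.1 p * c.n (c.act g q) p =
        ∑ᶠ p, b.1 g * d.1 (c.act g p) * c.n q p := fun g => by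
      rw [← finsum_comp_equiv (c.act g), mul_finsum]
      exact finsum_congr fun p => by rw [c.n_act]; ring
    rw [finsum_congr h1, finsum_congr h2]
    refine finsum_swap _ ?_
    obtain ⟨m, hm⟩ := c.op.bddAbove_of_mem d.2
    obtain ⟨w, hw⟩ := c.bddBelow_of_mem b.2
    refine (Set.Finite.image (fun x : Γ × P => (c.act x.1⁻¹ x.2, x.1))
      ((b.2.1 (c.A q + m + 1)).prod (d.2.1 (w - c.A q)))).subset ?_
    rintro ⟨p, g⟩ h
    have hb : b.1 g ≠ 0 := left_ne_zero_of_mul (left_ne_zero_of_mul h)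
    have hd : d.1 (c.act g p) ≠ 0 := right_ne_zero_of_mul (left_ne_zero_of_mul h)
    have hn : c.A p < c.A q := c.A_lt_of_n (right_ne_zero_of_mul h)
    have h3 : - c.A (c.act g p) ≤ m := hm _ hd
    have h4 := hw g hb
    have h5 := c.A_act g p
    refine ⟨(g, c.act g p), ⟨⟨hb, ?_⟩, hd, ?_⟩, ?_⟩
    · change (c.ω g).toAdd < _
      linarith
    · change w - c.A q < - c.A (c.act g p)
      linarith
    · simp
  bd_bd d := by
    refine Subtype.ext (funext fun q => ?_)
    change c.pairing (c.opBd d) (c.bd (c.gen K q)) = 0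
    rw [c.pairing_opBd, c.bd_bd]
    simp [Base.pairing]
  level_bd_lt d hd := by
    by_cases h0 : c.opBd d = 0
    · rw [h0]
      obtain ⟨p, -, hp⟩ := c.op.exists_level_eq d hd
      rw [hp]
      refine lt_of_le_of_lt (c.op.level_le (K := K) 0 (C := ⊥) fun p hp => ?_)
        (EReal.bot_lt_coe _)
      exact absurd rfl hp
    · obtain ⟨q, hq, hl⟩ := c.op.exists_level_eq _ h0
      rw [hl]
      obtain ⟨p, hp⟩ := exists_ne_zero_of_finsum hq
      have h1 := c.A_lt_of_n (right_ne_zero_of_mul hp)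
      refine lt_of_lt_of_le ?_ (c.op.le_level d (left_ne_zero_of_mul hp))
      rw [EReal.coe_lt_coe_iff]
      exact neg_lt_neg h1
  bd_mem k d hd q hq := by
    obtain ⟨p, hp⟩ := exists_ne_zero_of_finsum hq
    have h1 : - c.gr p = k := hd p (left_ne_zero_of_mul hp)
    have h2 := c.gr_of_n (right_ne_zero_of_mul hp)
    change - c.gr q = k - 1
    omega

/-- The space `∂ (C_k)` of boundaries of chains of degree `k`. -/
noncomputable def boundaries (c : FloerNovikovComplex K Γ P S) (k : ℤ) :
    Submodule K (c.chains K) :=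
  (c.chainsDeg K k).map c.bd

/-- The boundary depth `β_k`: the infimum of the real `β ≥ 0` such that, for all real `γ`,
`∂ (C_{k+1}) ∩ C_k^{(-∞, γ)} ⊆ ∂ (C_{k+1}^{(-∞, γ + β)})`.  The infimum is taken in the extended
reals, so it would be `⊤` if there were no such `β`. -/
noncomputable def boundaryDepth (c : FloerNovikovComplex K Γ P S) (k : ℤ) : EReal :=
  sInf ((fun β : ℝ => (β : EReal)) '' {β : ℝ | 0 ≤ β ∧ ∀ γ : ℝ,
    (c.boundaries (k + 1) : Set (c.chains K)) ∩ c.filtered K k γ ⊆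
      c.bd '' c.filtered K (k + 1) (γ + β)})

/-- The linking form `λ : δ (D_{-k+1}) × ∂ (C_k) → K`, with `λ (x, y) = Δ (x, a)` for any
`a ∈ C_k` with `∂ a = y`. -/
noncomputable def linkingForm (c : FloerNovikovComplex K Γ P S) (k : ℤ)
    (x : c.opposite.boundaries (-k + 1)) (y : c.boundaries k) : K :=
  c.pairing x.1 (Classical.choose (Submodule.mem_map.mp y.2))

/-- The linking form does not depend on the choice made in its definition. -/
theorem linkingForm_eq (c : FloerNovikovComplex K Γ P S) (k : ℤ)
    (x : c.opposite.boundaries (-k + 1)) (y : c.boundaries k) (a : c.chains K)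
    (hy : c.bd a = y.1) : c.linkingForm k x y = c.pairing x.1 a := by
  obtain ⟨d, -, hd⟩ := Submodule.mem_map.mp x.2
  have h := (Classical.choose_spec (Submodule.mem_map.mp y.2)).2
  unfold linkingForm
  have key : ∀ e : c.chains K, c.pairing x.1 e = c.pairing d (c.bd e) := fun e => by
    rw [← hd]
    exact c.pairing_opBd d e
  rw [key, key, h, hy]

end FloerNovikovComplex

end FloerNovikov

/-!
The period map identifies `ker deg` with a subgroup of `ℝ`, and over the Novikov field of this group
the chains of a given degree form a finite-dimensional vector space. The boundary operator becomes a
matrix, the opposite boundary operator its transpose, and levels become weighted maximum norms.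
Clearing pivots of maximal gain shows that a matrix and its transpose have the same optimal constant
for lifting vectors of the image, and that this constant is realized by a dual pair of vectors. This
bounds both boundary depths from above, and the dual pair is a pair of boundaries with nonzero
linking form. Conversely, chains with a nonzero pairing have levels of nonnegative sum, so every
linking pair bounds both boundary depths from below.
-/

namespace FloerNovikov

open Matrix

section WeightedSup

variable {R Γ₀ I : Type*} [Ring R] [LinearOrderedCommGroupWithZero Γ₀] [Fintype I]
  (v : Valuation R Γ₀)

/-- The weighted maximum norm `max_i α_i |x_i|` of a vector over a valued ring; the maximum over an
empty index set is `0`. -/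
def weightedSup (α : I → Γ₀) (x : I → R) : Γ₀ :=
  Finset.univ.sup fun i => α i * v (x i)

variable {v} {α : I → Γ₀}

theorem weightedSup_le_iff {x : I → R} {C : Γ₀} :
    weightedSup v α x ≤ C ↔ ∀ i, α i * v (x i) ≤ C := by
  simp only [weightedSup, Finset.sup_le_iff, Finset.mem_univ, true_implies]

theorem le_weightedSup (v : Valuation R Γ₀) (α : I → Γ₀) (x : I → R) (i : I) :
    α i * v (x i) ≤ weightedSup v α x :=
  weightedSup_le_iff.1 le_rfl i

theorem weightedSup_add_le (x y : I → R) :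
    weightedSup v α (x + y) ≤ max (weightedSup v α x) (weightedSup v α y) := by
  refine weightedSup_le_iff.2 fun i => ?_
  calc α i * v (x i + y i) ≤ α i * max (v (x i)) (v (y i)) :=
        mul_le_mul_right (v.map_add _ _) _
    _ = max (α i * v (x i)) (α i * v (y i)) := mul_max _ _ _
    _ ≤ _ := max_le_max (le_weightedSup v α x i) (le_weightedSup v α y i)

theorem weightedSup_smul_le (c : R) (x : I → R) :
    weightedSup v α (c • x) ≤ v c * weightedSup v α x := by
  refine weightedSup_le_iff.2 fun i => ?_
  rw [Pi.smul_apply, smul_eq_mul, map_mul, mul_left_comm]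
  exact mul_le_mul_right (le_weightedSup v α x i) _

theorem weightedSup_single_le [DecidableEq I] (i : I) (t : R) :
    weightedSup v α (Pi.single i t) ≤ α i * v t := by
  refine weightedSup_le_iff.2 fun j => ?_
  rcases eq_or_ne j i with rfl | hj
  · rw [Pi.single_eq_same]
  · rw [Pi.single_eq_of_ne hj, map_zero, mul_zero]
    exact zero_le

theorem valuation_dotProduct_le (hα : ∀ i, α i ≠ 0) (w x : I → R) :
    v (w ⬝ᵥ x) ≤ weightedSup v α⁻¹ w * weightedSup v α x := by
  refine v.map_sum_le fun i _ => ?_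
  calc v (w i * x i) = (α⁻¹ i * v (w i)) * (α i * v (x i)) := by
        rw [map_mul, Pi.inv_apply, mul_mul_mul_comm, inv_mul_cancel₀ (hα i), one_mul]
    _ ≤ _ := mul_le_mul' (le_weightedSup v α⁻¹ w i) (le_weightedSup v α x i)

theorem weightedSup_ne_zero_of_dotProduct_eq_one (hα : ∀ i, α i ≠ 0) {w x : I → R}
    (h : w ⬝ᵥ x = 1) : weightedSup v α x ≠ 0 := fun h₀ => by
  have hle := valuation_dotProduct_le (v := v) hα w x
  rw [h, h₀, map_one, mul_zero] at hle
  exact zero_lt_one.not_ge hle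

end WeightedSup

section ClearPivot

variable {F I J : Type*} [Field F]

/-- The matrix obtained from `A` by clearing the row and the column of the pivot `A j₀ i₀`; both
become zero, so that it has fewer nonzero rows than `A`. -/
def clearPivot (A : Matrix J I F) (i₀ : I) (j₀ : J) : Matrix J I F :=
  Matrix.of fun j i => A j i - (A j₀ i₀)⁻¹ * A j₀ i * A j i₀

theorem clearPivot_transpose (A : Matrix J I F) (i₀ : I) (j₀ : J) :
    clearPivot Aᵀ j₀ i₀ = (clearPivot A i₀ j₀)ᵀ := by
  ext i j
  simp only [clearPivot, of_apply, transpose_apply, mul_right_comm]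

theorem support_clearPivot_ssubset {A : Matrix J I F} {i₀ : I} {j₀ : J} (h : A j₀ i₀ ≠ 0) :
    Function.support (clearPivot A i₀ j₀) ⊂ Function.support A := by
  have hsub : Function.support (clearPivot A i₀ j₀) ⊆ Function.support A := by
    refine Function.support_subset_iff'.2 fun j hj => ?_
    have hAj : A j = 0 := Function.notMem_support.1 hj
    ext i
    simp only [clearPivot, hAj, of_apply, Pi.zero_apply, mul_zero, sub_zero]
  refine (Set.ssubset_iff_of_subset hsub).2 ⟨j₀, fun hA => h (congrFun hA i₀), ?_⟩
  refine Function.notMem_support.2 (funext fun i => ?_)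
  rw [Pi.zero_apply, clearPivot, of_apply, mul_right_comm, inv_mul_cancel₀ h, one_mul, sub_self]

variable [Fintype I]

theorem clearPivot_mulVec (A : Matrix J I F) (i₀ : I) (j₀ : J) (x : I → F) :
    clearPivot A i₀ j₀ *ᵥ x = A *ᵥ x - ((A j₀ i₀)⁻¹ * (A *ᵥ x) j₀) • A.col i₀ := by
  ext j
  simp only [clearPivot, mulVec, dotProduct, of_apply, sub_mul, Finset.sum_sub_distrib,
    Finset.mul_sum, Finset.sum_mul, Pi.sub_apply, Pi.smul_apply, smul_eq_mul, col_apply]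
  simp only [mul_assoc, mul_comm (A j i₀)]

theorem clearPivot_mulVec_pivot (A : Matrix J I F) {i₀ : I} {j₀ : J} (h : A j₀ i₀ ≠ 0)
    (x : I → F) : (clearPivot A i₀ j₀ *ᵥ x) j₀ = 0 := by
  rw [clearPivot_mulVec, Pi.sub_apply, Pi.smul_apply, smul_eq_mul, col_apply, mul_right_comm,
    inv_mul_cancel₀ h, one_mul, sub_self]

variable [DecidableEq I]

theorem mulVec_add_single (A : Matrix J I F) (x : I → F) (i₀ : I) (t : F) :
    A *ᵥ (x + Pi.single i₀ t) = A *ᵥ x + t • A.col i₀ := by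
  rw [mulVec_add, mulVec_single, op_smul_eq_smul]

theorem mulVec_add_single_eq_clearPivot_mulVec (A : Matrix J I F) (i₀ : I) (j₀ : J) (x : I → F) :
    A *ᵥ (x + Pi.single i₀ (-((A j₀ i₀)⁻¹ * (A *ᵥ x) j₀))) = clearPivot A i₀ j₀ *ᵥ x := by
  rw [mulVec_add_single, clearPivot_mulVec, neg_smul, sub_eq_add_neg]

end ClearPivot

section Pivot

variable {F Γ₀ I J : Type*} [Field F] [LinearOrderedCommGroupWithZero Γ₀] (v : Valuation F Γ₀)
  (α : I → Γ₀) (β : J → Γ₀)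

/-- The factor by which the entry `A j i` stretches the `i`-th basis vector, for the norms with
weights `α` on the source and `β` on the target. -/
def entryGain (A : Matrix J I F) (i : I) (j : J) : Γ₀ :=
  β j * v (A j i) * (α i)⁻¹

/-- The entry `A j₀ i₀` is a pivot: it is nonzero and has the largest gain among all entries. -/
structure IsPivot (A : Matrix J I F) (i₀ : I) (j₀ : J) : Prop where
  ne_zero : A j₀ i₀ ≠ 0
  gain_le : ∀ i j, entryGain v α β A i j ≤ entryGain v α β A i₀ j₀

variable {v α β} {A : Matrix J I F} {i₀ : I} {j₀ : J}

theorem entryGain_transpose (i : I) (j : J) :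
    entryGain v β⁻¹ α⁻¹ Aᵀ j i = entryGain v α β A i j := by
  simp only [entryGain, Pi.inv_apply, inv_inv, transpose_apply]
  rw [mul_comm, mul_comm (α i)⁻¹, mul_assoc]

theorem entryGain_ne_zero (hα : ∀ i, α i ≠ 0) (hβ : ∀ j, β j ≠ 0) {i : I} {j : J}
    (h : A j i ≠ 0) : entryGain v α β A i j ≠ 0 :=
  mul_ne_zero (mul_ne_zero (hβ j) (v.ne_zero_iff.2 h)) (inv_ne_zero (hα i))

theorem IsPivot.transpose (h : IsPivot v α β A i₀ j₀) : IsPivot v β⁻¹ α⁻¹ Aᵀ j₀ i₀ where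
  ne_zero := h.ne_zero
  gain_le j i := by
    simpa only [entryGain_transpose] using h.gain_le i j

theorem exists_isPivot [Finite I] [Finite J] (hα : ∀ i, α i ≠ 0) (hβ : ∀ j, β j ≠ 0)
    (hA : A ≠ 0) : ∃ i₀ j₀, IsPivot v α β A i₀ j₀ := by
  obtain ⟨j₁, i₁, h₁⟩ : ∃ j i, A j i ≠ 0 := by
    by_contra! h
    exact hA (Matrix.ext h)
  have : Nonempty (I × J) := ⟨(i₁, j₁)⟩
  obtain ⟨⟨i₀, j₀⟩, hmax⟩ := Finite.exists_max fun z : I × J => entryGain v α β A z.1 z.2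
  refine ⟨i₀, j₀, fun h₀ => ?_, fun i j => hmax (i, j)⟩
  have hle : entryGain v α β A i₁ j₁ ≤ 0 := by
    simpa only [entryGain, h₀, map_zero, mul_zero, zero_mul] using hmax (i₁, j₁)
  exact entryGain_ne_zero hα hβ h₁ (nonpos_iff_eq_zero.1 hle)

theorem IsPivot.weightedSup_col_le [Fintype J] (h : IsPivot v α β A i₀ j₀) (hα : α i₀ ≠ 0) :
    weightedSup v β (A.col i₀) ≤ β j₀ * v (A j₀ i₀) :=
  weightedSup_le_iff.2 fun j =>
    le_of_mul_le_mul_right (h.gain_le i₀ j) (pos_iff_ne_zero.2 (inv_ne_zero hα))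

theorem IsPivot.weightedSup_row_le [Fintype I] (h : IsPivot v α β A i₀ j₀) (hβ : β j₀ ≠ 0) :
    weightedSup v α⁻¹ (A.row j₀) ≤ (α i₀)⁻¹ * v (A j₀ i₀) :=
  h.transpose.weightedSup_col_le (inv_ne_zero hβ)

theorem IsPivot.weightedSup_clearPivot_mulVec_le [Fintype I] [Fintype J]
    (h : IsPivot v α β A i₀ j₀) (hα : α i₀ ≠ 0) (x : I → F) :
    weightedSup v β (clearPivot A i₀ j₀ *ᵥ x) ≤ weightedSup v β (A *ᵥ x) := by
  have ha : v (A j₀ i₀) ≠ 0 := v.ne_zero_iff.2 h.ne_zero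
  rw [clearPivot_mulVec, sub_eq_add_neg, ← neg_smul]
  refine (weightedSup_add_le _ _).trans (max_le le_rfl ?_)
  calc weightedSup v β (-((A j₀ i₀)⁻¹ * (A *ᵥ x) j₀) • A.col i₀)
      ≤ v ((A j₀ i₀)⁻¹ * (A *ᵥ x) j₀) * (β j₀ * v (A j₀ i₀)) := by
        refine (weightedSup_smul_le _ _).trans ?_
        rw [Valuation.map_neg]
        exact mul_le_mul_right (h.weightedSup_col_le hα) _
    _ = β j₀ * v ((A *ᵥ x) j₀) := by
        rw [map_mul, map_inv₀, mul_comm, mul_assoc, mul_inv_cancel_left₀ ha]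
    _ ≤ weightedSup v β (A *ᵥ x) := le_weightedSup v β _ j₀

theorem IsPivot.mul_valuation_le_weightedSup [Fintype I] (h : IsPivot v α β A i₀ j₀)
    (hα : ∀ i, α i ≠ 0) (hβ : β j₀ ≠ 0) (x : I → F) :
    α i₀ * v ((A j₀ i₀)⁻¹ * (A *ᵥ x) j₀) ≤ weightedSup v α x := by
  have ha : v (A j₀ i₀) ≠ 0 := v.ne_zero_iff.2 h.ne_zero
  calc α i₀ * v ((A j₀ i₀)⁻¹ * (A *ᵥ x) j₀)
      ≤ α i₀ * (v (A j₀ i₀))⁻¹ * ((α i₀)⁻¹ * v (A j₀ i₀) * weightedSup v α x) := by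
        rw [map_mul, map_inv₀, ← mul_assoc]
        refine mul_le_mul_right ((valuation_dotProduct_le hα _ x).trans ?_) _
        exact mul_le_mul_left (h.weightedSup_row_le hβ) _
    _ = weightedSup v α x := by
        rw [← mul_assoc, mul_mul_mul_comm, mul_inv_cancel₀ (hα i₀), inv_mul_cancel₀ ha, one_mul,
          one_mul]

end Pivot

section BoundedLift

variable {F Γ₀ I J : Type*} [Field F] [LinearOrderedCommGroupWithZero Γ₀] (v : Valuation F Γ₀)
  [Fintype I] [Fintype J] (α : I → Γ₀) (β : J → Γ₀)

/-- Every vector in the image of `A` has a preimage which is larger by a factor of at most `B`, for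
the norms with weights `α` on the source and `β` on the target. -/
def BoundedLift (A : Matrix J I F) (B : Γ₀) : Prop :=
  ∀ x, ∃ x', A *ᵥ x' = A *ᵥ x ∧ weightedSup v α x' ≤ B * weightedSup v β (A *ᵥ x)

/-- A certificate that neither `A` nor its transpose has bounded lifts with a constant smaller
than `B`: for any preimage `x'` of `A x`, the pairing `w ⬝ᵥ A x' = Aᵀ w ⬝ᵥ x'` equals `1`, which
bounds the norm of `x'` from below, and symmetrically for `Aᵀ w`. -/
def DualWitness (A : Matrix J I F) (B : Γ₀) : Prop :=
  ∃ x w, w ⬝ᵥ A *ᵥ x = 1 ∧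
    B * (weightedSup v β (A *ᵥ x) * weightedSup v α⁻¹ (Aᵀ *ᵥ w)) ≤ 1

variable {v α β} {A : Matrix J I F} {B B' : Γ₀} {i₀ : I} {j₀ : J}

theorem BoundedLift.mono (h : BoundedLift v α β A B) (hB : B ≤ B') : BoundedLift v α β A B' :=
  fun x =>
    let ⟨x', hx', hle⟩ := h x
    ⟨x', hx', hle.trans (mul_le_mul_left hB _)⟩

theorem boundedLift_zero (v : Valuation F Γ₀) (α : I → Γ₀) (β : J → Γ₀) (B : Γ₀) :
    BoundedLift v α β (0 : Matrix J I F) B := fun x =>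
  ⟨0, by simp only [zero_mulVec],
    weightedSup_le_iff.2 fun i => by simp only [Pi.zero_apply, map_zero, mul_zero, zero_le]⟩

theorem BoundedLift.of_clearPivot (hα : ∀ i, α i ≠ 0) (hβ : β j₀ ≠ 0)
    (hpiv : IsPivot v α β A i₀ j₀) (hB : (entryGain v α β A i₀ j₀)⁻¹ ≤ B)
    (h : BoundedLift v α β (clearPivot A i₀ j₀) B) : BoundedLift v α β A B := by
  classical
  intro x
  obtain ⟨x', hx', hle⟩ := h x
  rw [clearPivot_mulVec, clearPivot_mulVec] at hx'
  replace hle : weightedSup v α x' ≤ B * weightedSup v β (A *ᵥ x) :=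
    hle.trans (mul_le_mul_right (hpiv.weightedSup_clearPivot_mulVec_le (hα i₀) x) _)
  set a := A j₀ i₀ with ha
  have hx : α i₀ * v (a⁻¹ * (A *ᵥ x) j₀) ≤ B * weightedSup v β (A *ᵥ x) := by
    calc α i₀ * v (a⁻¹ * (A *ᵥ x) j₀)
        = (entryGain v α β A i₀ j₀)⁻¹ * (β j₀ * v ((A *ᵥ x) j₀)) := by
          rw [entryGain, ← ha, mul_inv, mul_inv, inv_inv, map_mul, map_inv₀, mul_mul_mul_comm,
            mul_right_comm _ _ (β j₀), inv_mul_cancel₀ hβ, one_mul, mul_left_comm]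
      _ ≤ _ := mul_le_mul' hB (le_weightedSup v β _ j₀)
  refine ⟨x' + Pi.single i₀ (a⁻¹ * (A *ᵥ x) j₀ - a⁻¹ * (A *ᵥ x') j₀), ?_, ?_⟩
  · rw [mulVec_add_single, sub_smul, add_sub, add_sub_right_comm, hx', sub_add_cancel]
  · refine (weightedSup_add_le _ _).trans (max_le hle ((weightedSup_single_le _ _).trans ?_))
    calc _ ≤ α i₀ * max (v (a⁻¹ * (A *ᵥ x) j₀)) (v (a⁻¹ * (A *ᵥ x') j₀)) :=
          mul_le_mul_right (v.map_sub _ _) _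
      _ = max (α i₀ * v (a⁻¹ * (A *ᵥ x) j₀)) (α i₀ * v (a⁻¹ * (A *ᵥ x') j₀)) := mul_max _ _ _
      _ ≤ _ := max_le hx ((hpiv.mul_valuation_le_weightedSup hα hβ x').trans hle)

theorem IsPivot.dualWitness (hα : α i₀ ≠ 0) (hβ : β j₀ ≠ 0) (h : IsPivot v α β A i₀ j₀) :
    DualWitness v α β A (entryGain v α β A i₀ j₀)⁻¹ := by
  classical
  have ha : v (A j₀ i₀) ≠ 0 := v.ne_zero_iff.2 h.ne_zero
  have hx : A *ᵥ Pi.single i₀ (A j₀ i₀)⁻¹ = (A j₀ i₀)⁻¹ • A.col i₀ := by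
    rw [mulVec_single, op_smul_eq_smul]
  have hw : Aᵀ *ᵥ Pi.single j₀ 1 = A.row j₀ := by
    rw [mulVec_single_one, col_transpose]
  refine ⟨Pi.single i₀ (A j₀ i₀)⁻¹, Pi.single j₀ 1, ?_, ?_⟩
  · rw [single_one_dotProduct, hx, Pi.smul_apply, col_apply, smul_eq_mul, inv_mul_cancel₀ h.ne_zero]
  · rw [hx, hw]
    calc _ ≤ (entryGain v α β A i₀ j₀)⁻¹ *
          (v (A j₀ i₀)⁻¹ * (β j₀ * v (A j₀ i₀)) * ((α i₀)⁻¹ * v (A j₀ i₀))) := by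
          gcongr
          · exact (weightedSup_smul_le _ _).trans (mul_le_mul_right (h.weightedSup_col_le hα) _)
          · exact h.weightedSup_row_le hβ
      _ = 1 := by
          rw [entryGain, map_inv₀]
          field_simp

theorem DualWitness.of_clearPivot (h₀ : A j₀ i₀ ≠ 0)
    (h : DualWitness v α β (clearPivot A i₀ j₀) B) : DualWitness v α β A B := by
  classical
  obtain ⟨x, w, hxw, hle⟩ := h
  refine ⟨x + Pi.single i₀ (-((A j₀ i₀)⁻¹ * (A *ᵥ x) j₀)),
    w + Pi.single j₀ (-((Aᵀ i₀ j₀)⁻¹ * (Aᵀ *ᵥ w) i₀)), ?_, ?_⟩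
  · rw [mulVec_add_single_eq_clearPivot_mulVec, add_dotProduct, single_dotProduct,
      clearPivot_mulVec_pivot A h₀, mul_zero, add_zero, hxw]
  · rwa [mulVec_add_single_eq_clearPivot_mulVec, mulVec_add_single_eq_clearPivot_mulVec,
      clearPivot_transpose]

theorem exists_boundedLift_and_transpose (hα : ∀ i, α i ≠ 0) (hβ : ∀ j, β j ≠ 0)
    (A : Matrix J I F) :
    ∃ B, BoundedLift v α β A B ∧ BoundedLift v β⁻¹ α⁻¹ Aᵀ B ∧
      (B = 0 ∨ DualWitness v α β A B) := by
  induction hn : Function.support A using WellFoundedLT.induction generalizing A with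
  | ind _ ih =>
  rcases eq_or_ne A 0 with rfl | hA
  · exact ⟨0, boundedLift_zero v α β 0, boundedLift_zero v β⁻¹ α⁻¹ 0, Or.inl rfl⟩
  obtain ⟨i₀, j₀, hpiv⟩ := exists_isPivot (v := v) hα hβ hA
  obtain ⟨B, hlift, hliftT, hwit⟩ :=
    ih _ (hn ▸ support_clearPivot_ssubset hpiv.ne_zero) (clearPivot A i₀ j₀) rfl
  set s := (entryGain v α β A i₀ j₀)⁻¹
  refine ⟨max B s, ?_, ?_, Or.inr ?_⟩
  · exact (hlift.mono (le_max_left _ _)).of_clearPivot hα (hβ j₀) hpiv (le_max_right _ _)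
  · refine BoundedLift.of_clearPivot (fun j => inv_ne_zero (hβ j)) (inv_ne_zero (hα i₀))
      hpiv.transpose ?_ ?_
    · rw [entryGain_transpose]
      exact le_max_right _ _
    · rw [clearPivot_transpose]
      exact hliftT.mono (le_max_left _ _)
  · have hwit_s := hpiv.dualWitness (hα i₀) (hβ j₀)
    rcases le_total B s with hBs | hsB
    · rwa [max_eq_right hBs]
    rcases hwit with rfl | hwit
    · rwa [max_eq_right zero_le]
    · rw [max_eq_left hsB]
      exact hwit.of_clearPivot hpiv.ne_zero

end BoundedLift

section NovikovField

open scoped Pointwise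

variable {G : Type*} [LinearOrder G]

/-- Only finitely many elements of `s` lie below any given element, the finiteness condition on the
supports of Novikov series. -/
def FiniteBelow (s : Set G) : Prop :=
  ∀ C, (s ∩ Set.Iio C).Finite

theorem FiniteBelow.mono {s t : Set G} (ht : FiniteBelow t) (hst : s ⊆ t) : FiniteBelow s :=
  fun C => (ht C).subset (Set.inter_subset_inter_left _ hst)

theorem finiteBelow_of_finite {s : Set G} (hs : s.Finite) : FiniteBelow s :=
  fun _ => hs.inter_of_left _

theorem FiniteBelow.union {s t : Set G} (hs : FiniteBelow s) (ht : FiniteBelow t) :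
    FiniteBelow (s ∪ t) := fun C => by
  rw [Set.union_inter_distrib_right]
  exact (hs C).union (ht C)

theorem FiniteBelow.isPWO {s : Set G} (hs : FiniteBelow s) : s.IsPWO := by
  refine Set.isPWO_iff_isWF.2 (Set.isWF_iff_no_descending_seq.2 fun f hf hmem => ?_)
  refine Set.infinite_range_of_injective (hf.injective.comp (add_left_injective 1))
    ((hs (f 0)).subset ?_)
  rintro _ ⟨n, rfl⟩
  exact ⟨hmem _, hf n.succ_pos⟩

theorem FiniteBelow.bddBelow [Nonempty G] {s : Set G} (hs : FiniteBelow s) : BddBelow s := by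
  rcases s.eq_empty_or_nonempty with rfl | hne
  · exact bddBelow_empty
  · exact ⟨hs.isPWO.isWF.min hne, fun a ha => hs.isPWO.isWF.min_le hne ha⟩

variable [AddCommGroup G] [IsOrderedAddMonoid G]

theorem FiniteBelow.add {s t : Set G} (hs : FiniteBelow s)
    (ht : FiniteBelow t) : FiniteBelow (s + t) := by
  obtain ⟨a, ha⟩ := hs.bddBelow
  obtain ⟨b, hb⟩ := ht.bddBelow
  intro C
  refine ((hs (C - b)).add (ht (C - a))).subset ?_
  rintro _ ⟨⟨x, hx, y, hy, rfl⟩, hC⟩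
  refine Set.add_mem_add ⟨hx, lt_sub_iff_add_lt.2 ?_⟩ ⟨hy, lt_sub_iff_add_lt'.2 ?_⟩
  · exact (add_le_add_right (hb hy) x).trans_lt hC
  · exact (add_le_add_left (ha hx) y).trans_lt hC

theorem FiniteBelow.of_subset_insert_add [Archimedean G] {s t : Set G}
    {t₀ : G} (hs : FiniteBelow s) (hpos : ∀ a ∈ s, 0 < a) (hbdd : BddBelow t)
    (ht : t ⊆ insert t₀ (s + t)) : FiniteBelow t := by
  rcases s.eq_empty_or_nonempty with rfl | hne
  · rw [Set.empty_add] at ht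
    exact finiteBelow_of_finite ((Set.toFinite _).subset ht)
  obtain ⟨m, hm⟩ := hbdd
  let ε := hs.isPWO.isWF.min hne
  have hε : 0 < ε := hpos _ (hs.isPWO.isWF.min_mem hne)
  have hεs : ∀ a ∈ s, ε ≤ a := fun a ha => hs.isPWO.isWF.min_le hne ha
  have hfin : ∀ n : ℕ, (t ∩ Set.Iio (m + n • ε)).Finite := by
    intro n
    induction n with
    | zero =>
      refine Set.finite_empty.subset fun x ⟨hx, hlt⟩ => (hm hx).not_gt ?_
      rwa [zero_nsmul, add_zero] at hlt
    | succ n ih =>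
      refine (((hs ((n + 1) • ε)).add ih).insert t₀).subset fun x ⟨hx, hlt⟩ => ?_
      refine (ht hx).imp_right ?_
      rintro ⟨a, ha, y, hy, rfl⟩
      replace hlt : a + y < m + (n + 1) • ε := hlt
      refine Set.add_mem_add ⟨ha, ?_⟩ ⟨hy, ?_⟩
      · exact lt_of_add_lt_add_right (hlt.trans_le' (add_le_add_right (hm hy) a) |>.trans_eq
          (add_comm _ _))
      · rw [succ_nsmul', add_left_comm] at hlt
        exact lt_of_add_lt_add_left (hlt.trans_le' (add_le_add_left (hεs a ha) y))
  intro C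
  obtain ⟨n, hn⟩ := Archimedean.arch (C - m) hε
  exact (hfin n).subset (Set.inter_subset_inter_right _
    (Set.Iio_subset_Iio (sub_le_iff_le_add'.1 hn)))

variable {K : Type*} [Field K]

theorem support_inv_subset {x : HahnSeries G K} (hx : x ≠ 0) :
    x⁻¹.support ⊆ insert (-x.order) ({-x.order} + x.support \ {x.order} + x⁻¹.support) := by
  set l := HahnSeries.single x.order x.leadingCoeff with hl
  have hl₀ : l ≠ 0 := HahnSeries.single_ne_zero (HahnSeries.leadingCoeff_ne_zero.2 hx)
  have htail : (x - l).support ⊆ x.support \ {x.order} := by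
    intro g hg
    rw [HahnSeries.mem_support, HahnSeries.coeff_sub] at hg
    rcases eq_or_ne g x.order with rfl | hne
    · rw [hl, HahnSeries.coeff_single_same, ← HahnSeries.leadingCoeff_eq, sub_self] at hg
      exact absurd rfl hg
    · rw [hl, HahnSeries.coeff_single_of_ne hne, sub_zero] at hg
      exact ⟨hg, hne⟩
  -- the geometric series of `1 - (x - l) / l`, in recursive form
  have hrec : x⁻¹ = l⁻¹ * (1 - (x - l) * x⁻¹) := by
    rw [eq_inv_mul_iff_mul_eq₀ hl₀, sub_mul, mul_inv_cancel₀ hx, sub_sub_cancel]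
  calc x⁻¹.support = (l⁻¹ * (1 - (x - l) * x⁻¹)).support := congrArg _ hrec
    _ ⊆ {-x.order} + ({0} ∪ (x.support \ {x.order} + x⁻¹.support)) := by
        refine HahnSeries.support_mul_subset.trans (Set.add_subset_add ?_ ?_)
        · rw [hl, HahnSeries.inv_single]
          exact HahnSeries.support_single_subset
        · refine (HahnSeries.support_sub_subset _ _).trans (Set.union_subset_union ?_ ?_)
          · rw [HahnSeries.support_one]
          · exact HahnSeries.support_mul_subset.trans (Set.add_subset_add_right htail)
    _ = _ := by
        rw [Set.add_union, Set.singleton_add_singleton, add_zero, ← add_assoc, Set.insert_eq]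

theorem finiteBelow_support_inv [Archimedean G] {x : HahnSeries G K} (h : FiniteBelow x.support) :
    FiniteBelow x⁻¹.support := by
  rcases eq_or_ne x 0 with rfl | hx
  · rw [_root_.inv_zero, HahnSeries.support_zero]
    exact finiteBelow_of_finite Set.finite_empty
  · refine FiniteBelow.of_subset_insert_add
      ((finiteBelow_of_finite (Set.finite_singleton _)).add (h.mono Set.sdiff_subset)) ?_
      ⟨x⁻¹.order, fun g hg => HahnSeries.order_le_of_coeff_ne_zero hg⟩ (support_inv_subset hx)
    rintro _ ⟨_, rfl, g, ⟨hg, hne⟩, rfl⟩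
    exact lt_neg_add_iff_lt.2 ((HahnSeries.order_le_of_coeff_ne_zero hg).lt_of_ne' hne)

/-- The Novikov field of an Archimedean ordered group `G`: the Hahn series over `G` which have only
finitely many terms below each element of `G`. -/
def novikovField (G K : Type*) [AddCommGroup G] [LinearOrder G] [IsOrderedAddMonoid G]
    [Archimedean G] [Field K] : Subfield (HahnSeries G K) where
  carrier := {x | FiniteBelow x.support}
  zero_mem' := finiteBelow_of_finite (by rw [HahnSeries.support_zero]; exact Set.finite_empty)
  one_mem' := finiteBelow_of_finite (by rw [HahnSeries.support_one]; exact Set.finite_singleton 0)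
  add_mem' hx hy := (hx.union hy).mono (HahnSeries.support_add_subset _ _)
  neg_mem' hx := hx.mono (HahnSeries.support_neg_subset _)
  mul_mem' hx hy := (hx.add hy).mono HahnSeries.support_mul_subset
  inv_mem' _ hx := finiteBelow_support_inv hx

theorem coeff_mul_eq_finsum (x y : HahnSeries G K) (a : G) :
    (x * y).coeff a = ∑ᶠ g, x.coeff g * y.coeff (a - g) := by
  classical
  rw [HahnSeries.coeff_mul, finsum_eq_sum_of_support_subset
    (s := (Finset.antidiagonal x.isPWO_support y.isPWO_support a).image Prod.fst)]
  · rw [Finset.sum_image]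
    · refine Finset.sum_congr rfl fun z hz => ?_
      rw [← (Finset.mem_antidiagonal.1 hz).2.2, add_sub_cancel_left]
    · intro z hz w hw h
      have hz' := (Finset.mem_antidiagonal.1 hz).2.2
      rw [h, ← (Finset.mem_antidiagonal.1 hw).2.2] at hz'
      exact Prod.ext h (add_left_cancel hz')
  · intro g hg
    rw [Finset.coe_image]
    exact ⟨(g, a - g), Finset.mem_coe.2 (Finset.mem_antidiagonal.2
      ⟨left_ne_zero_of_mul hg, right_ne_zero_of_mul hg, add_sub_cancel _ _⟩), rfl⟩

end NovikovField

section OrderValuation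

open scoped WithZero

variable {G : AddSubgroup ℝ} {K : Type*} [Field K]

theorem finiteBelow_iff_real {s : Set G} :
    FiniteBelow s ↔ ∀ C : ℝ, {g | g ∈ s ∧ (g : ℝ) < C}.Finite := by
  refine ⟨fun h C => ?_, fun h C => h C⟩
  by_cases hC : ∃ c : G, C ≤ c
  · obtain ⟨c, hc⟩ := hC
    exact (h c).subset fun g hg => ⟨hg.1, hg.2.trans_le hc⟩
  -- no positive element of `G` exists, as its multiples would exceed `C`
  · push Not at hC
    have hG : ∀ g : G, g ≤ 0 := fun g => le_of_not_gt fun hg => by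
      obtain ⟨n, hn⟩ := Archimedean.arch C (show (0 : ℝ) < g from hg)
      exact (hC (n • g)).not_ge (by simpa only [AddSubgroup.coe_nsmul] using hn)
    exact (Set.finite_singleton (0 : G)).subset fun g _ =>
      le_antisymm (hG g) (neg_nonpos.1 (hG (-g)))

open Classical in
/-- The non-Archimedean valuation `x ↦ e^(-order x)` on Hahn series with real exponents, written
with the formal exponential of `ℝᵐ⁰`, so that chains of level at most `r` correspond to vectors of
norm at most `exp r`. -/
noncomputable def orderValuation (G : AddSubgroup ℝ) (K : Type*) [Field K] :
    Valuation (HahnSeries G K) ℝᵐ⁰ where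
  toFun x := if x = 0 then 0 else WithZero.exp (-(x.order : ℝ))
  map_zero' := if_pos rfl
  map_one' := by
    rw [if_neg one_ne_zero, HahnSeries.order_one, AddSubgroup.coe_zero, neg_zero, WithZero.exp_zero]
  map_mul' x y := by
    rcases eq_or_ne x 0 with rfl | hx
    · simp only [zero_mul, if_true]
    rcases eq_or_ne y 0 with rfl | hy
    · simp only [mul_zero, if_true]
    rw [if_neg hx, if_neg hy, if_neg (mul_ne_zero hx hy), ← WithZero.exp_add,
      HahnSeries.order_mul hx hy, AddSubgroup.coe_add, neg_add]
  map_add_le_max' x y := by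
    rcases eq_or_ne x 0 with rfl | hx
    · simp only [zero_add, le_max_right]
    rcases eq_or_ne y 0 with rfl | hy
    · simp only [add_zero, le_max_left]
    rcases eq_or_ne (x + y) 0 with hxy | hxy
    · simp only [hxy, if_true, zero_le]
    rw [if_neg hx, if_neg hy, if_neg hxy, le_max_iff, WithZero.exp_le_exp, WithZero.exp_le_exp,
      neg_le_neg_iff, neg_le_neg_iff]
    exact min_le_iff.1 (HahnSeries.min_order_le_order_add hxy)

theorem orderValuation_le_exp_iff {x : HahnSeries G K} {r : ℝ} :
    orderValuation G K x ≤ WithZero.exp r ↔ ∀ g : G, x.coeff g ≠ 0 → -(g : ℝ) ≤ r := by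
  classical
  change (if x = 0 then 0 else WithZero.exp (-(x.order : ℝ))) ≤ _ ↔ _
  rcases eq_or_ne x 0 with rfl | hx
  · simp
  rw [if_neg hx, WithZero.exp_le_exp]
  refine ⟨fun h g hg => (neg_le_neg ?_).trans h, fun h => h _ ?_⟩
  · exact HahnSeries.order_le_of_coeff_ne_zero hg
  · exact HahnSeries.coeff_order_eq_zero.not.2 hx

/-- The restriction of the order valuation to the Novikov field. -/
noncomputable abbrev novikovValuation (G : AddSubgroup ℝ) (K : Type*) [Field K] :
    Valuation (novikovField G K) ℝᵐ⁰ :=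
  (orderValuation G K).comap (novikovField G K).subtype

end OrderValuation

section Coordinates

open scoped WithZero

/-- An identification of `ker deg` with the group `G` of its periods. -/
structure PeriodLift {Γ P S : Type*} [CommGroup Γ] (B : Base Γ P S) (G : AddSubgroup ℝ) where
  lift : Multiplicative G →* Γ
  deg_lift : ∀ g, B.deg (lift g) = 1
  toAdd_ω_lift : ∀ g, (B.ω (lift g)).toAdd = g.toAdd
  exists_lift : ∀ γ, B.deg γ = 1 → ∃ g, lift g = γ

variable {K Γ P S I J : Type*} [Field K] [CommGroup Γ] {B : Base Γ P S} {G : AddSubgroup ℝ}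

namespace PeriodLift

theorem lift_injective (L : PeriodLift B G) : Function.Injective L.lift := fun g h hgh =>
  Multiplicative.toAdd.injective
    (Subtype.ext (by rw [← L.toAdd_ω_lift, ← L.toAdd_ω_lift, hgh]))

/-- The same identification for the opposite data, which have the same `ω` and `deg`. -/
def op (L : PeriodLift B G) : PeriodLift B.op G where
  lift := L.lift
  deg_lift := L.deg_lift
  toAdd_ω_lift := L.toAdd_ω_lift
  exists_lift := L.exists_lift

end PeriodLift

theorem exists_periodLift (B : Base Γ P S) (hinj : Set.InjOn B.ω (B.deg.ker : Set Γ)) :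
    ∃ G : AddSubgroup ℝ, Nonempty (PeriodLift B G) := by
  let ωker : B.deg.ker →* Multiplicative ℝ := B.ω.domRestrict B.deg.ker
  have hωker : Function.Injective ωker := Set.injOn_iff_injective.1 hinj
  let e : B.deg.ker ≃* ωker.range := MonoidHom.ofInjective hωker
  let f : ωker.range →* Γ := B.deg.ker.subtype.comp e.symm.toMonoidHom
  refine ⟨Subgroup.toAddSubgroup' ωker.range, ⟨⟨f, fun g => (e.symm g).2, fun g => ?_, fun γ hγ =>
    ⟨e ⟨γ, hγ⟩, congrArg Subtype.val (e.symm_apply_apply _)⟩⟩⟩⟩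
  exact congrArg Subtype.val (e.apply_symm_apply g)

/-- Representatives of the `ker deg`-orbits in degree `k`. Through the period lift, the elements of
`P` of degree `k` are parametrized by `I × G`, and the chains of degree `k` become vectors indexed
by `I` over the Novikov field of `G`. -/
structure OrbitBasis (L : PeriodLift B G) (k : ℤ) (I : Type*) where
  base : I → P
  gr_base : ∀ i, B.gr (base i) = k
  proj_base_injective : Function.Injective fun i => B.proj (base i)
  exists_proj_base : ∀ p, B.gr p = k → ∃ i, B.proj (base i) = B.proj p

theorem exists_orbitBasis (L : PeriodLift B G) (k : ℤ) :
    Nonempty (OrbitBasis L k {s : S // ∃ p, B.proj p = s ∧ B.gr p = k}) := by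
  choose base hproj hgr using fun s : {s : S // ∃ p, B.proj p = s ∧ B.gr p = k} => s.2
  exact ⟨⟨base, hgr, fun i j hij => Subtype.ext (by simpa only [hproj] using hij),
    fun p hp => ⟨⟨B.proj p, p, rfl, hp⟩, hproj _⟩⟩⟩

namespace OrbitBasis

variable {L : PeriodLift B G} {k m : ℤ}

/-- The element of `P` with coordinates `(i, g)`. -/
def pt (φ : OrbitBasis L k I) (i : I) (g : G) : P :=
  B.act (L.lift (Multiplicative.ofAdd g)) (φ.base i)

theorem act_pt (φ : OrbitBasis L k I) (h : G) (i : I) (g : G) :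
    B.act (L.lift (Multiplicative.ofAdd h)) (φ.pt i g) = φ.pt i (h + g) := by
  rw [pt, pt, ofAdd_add, map_mul, map_mul, Equiv.Perm.mul_apply]

theorem A_pt (φ : OrbitBasis L k I) (i : I) (g : G) :
    B.A (φ.pt i g) = B.A (φ.base i) - g := by
  rw [pt, B.A_act, L.toAdd_ω_lift, toAdd_ofAdd]

theorem gr_pt (φ : OrbitBasis L k I) (i : I) (g : G) : B.gr (φ.pt i g) = k := by
  rw [pt, B.gr_act, L.deg_lift, toAdd_one, sub_zero, φ.gr_base]

theorem pt_injective (φ : OrbitBasis L k I) :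
    Function.Injective fun z : I × G => φ.pt z.1 z.2 := by
  have proj_pt (i : I) (g : G) : B.proj (φ.pt i g) = B.proj (φ.base i) :=
    ((B.proj_eq_iff _ _).2 ⟨_, rfl⟩).symm
  rintro ⟨i, g⟩ ⟨j, h⟩ hpt
  obtain rfl : i = j := φ.proj_base_injective (by
    simpa only [proj_pt] using congrArg B.proj hpt)
  have hfix := B.act_free ((L.lift (Multiplicative.ofAdd h))⁻¹ * L.lift (Multiplicative.ofAdd g))
    (φ.base i) (by
      rw [map_mul, Equiv.Perm.mul_apply]
      exact (congrArg _ hpt).trans (B.act_inv_act _ _))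
  rw [← Multiplicative.ofAdd.injective (L.lift_injective (inv_mul_eq_one.1 hfix))]

theorem exists_pt (φ : OrbitBasis L k I) {p : P} (hp : B.gr p = k) : ∃ i g, φ.pt i g = p := by
  obtain ⟨i, hi⟩ := φ.exists_proj_base p hp
  obtain ⟨γ, rfl⟩ := (B.proj_eq_iff _ _).1 hi
  have hγ : B.deg γ = 1 := by
    rw [B.gr_act, φ.gr_base, sub_eq_self] at hp
    exact Multiplicative.toAdd.injective hp
  obtain ⟨g, rfl⟩ := L.exists_lift γ hγ
  exact ⟨i, g.toAdd, rfl⟩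

theorem finsum_eq [Fintype I] (φ : OrbitBasis L k I) {f : P → K}
    (hf : ∀ p, f p ≠ 0 → B.gr p = k) (hfin : (Function.support f).Finite) :
    ∑ᶠ p, f p = ∑ i, ∑ᶠ g, f (φ.pt i g) := by
  have hsupp : Function.support f ⊆ Set.range fun z : I × G => φ.pt z.1 z.2 := fun p hp =>
    let ⟨i, g, hpt⟩ := φ.exists_pt (hf p hp)
    ⟨(i, g), hpt⟩
  rw [← finsum_eq_sum_of_fintype, ← finsum_curry _ (hfin.preimage φ.pt_injective.injOn),
    ← finsum_mem_range φ.pt_injective (f := f), finsum_mem_def, Set.indicator_eq_self.2 hsupp]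

/-- The function on `P` whose value at `φ.pt i g` is the `g`-th coefficient of `x i`. -/
noncomputable def chainFun (φ : OrbitBasis L k I) (x : I → novikovField G K) : P → K :=
  Function.extend (fun z : I × G => φ.pt z.1 z.2) (fun z => (x z.1).1.coeff z.2) 0

theorem chainFun_pt (φ : OrbitBasis L k I) (x : I → novikovField G K) (i : I) (g : G) :
    φ.chainFun x (φ.pt i g) = (x i).1.coeff g :=
  φ.pt_injective.extend_apply _ _ (i, g)

theorem gr_eq_of_chainFun_ne_zero (φ : OrbitBasis L k I) {x : I → novikovField G K} {p : P}
    (hp : φ.chainFun x p ≠ 0) : B.gr p = k := by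
  by_contra hgr
  refine hp (Function.extend_apply' _ _ _ ?_)
  rintro ⟨z, rfl⟩
  exact hgr (φ.gr_pt _ _)

/-- The chain of degree `k` with coordinate vector `x`. -/
noncomputable def chain [Finite I] (φ : OrbitBasis L k I) (x : I → novikovField G K) :
    B.chains K := ⟨φ.chainFun x, by
  refine ⟨fun C => ?_, (Set.finite_singleton k).subset ?_⟩
  · refine (Set.finite_iUnion fun i => (finiteBelow_iff_real.1 (x i).2
      (B.A (φ.base i) - C)).image fun g => φ.pt i g).subset ?_
    rintro p ⟨hp, hC⟩
    obtain ⟨i, g, rfl⟩ := φ.exists_pt (φ.gr_eq_of_chainFun_ne_zero hp)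
    rw [φ.chainFun_pt] at hp
    rw [φ.A_pt] at hC
    exact Set.mem_iUnion.2 ⟨i, g, ⟨hp, by linarith⟩, rfl⟩
  · rintro _ ⟨p, hp, rfl⟩
    exact φ.gr_eq_of_chainFun_ne_zero hp⟩

theorem chain_pt [Finite I] (φ : OrbitBasis L k I) (x : I → novikovField G K) (i : I) (g : G) :
    (φ.chain x).1 (φ.pt i g) = (x i).1.coeff g :=
  φ.chainFun_pt x i g

theorem chain_mem [Finite I] (φ : OrbitBasis L k I) (x : I → novikovField G K) :
    φ.chain x ∈ B.chainsDeg K k :=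
  fun _ hp => φ.gr_eq_of_chainFun_ne_zero hp

/-- The coordinate vector of a chain, which only depends on its component of degree `k`. -/
noncomputable def coord (φ : OrbitBasis L k I) (a : B.chains K) (i : I) : novikovField G K :=
  have ha : FiniteBelow {g : G | a.1 (φ.pt i g) ≠ 0} := finiteBelow_iff_real.2 fun C => by
    refine Set.Finite.of_finite_image ((a.2.1 (B.A (φ.base i) - C)).subset ?_)
      (φ.pt_injective.comp (Prod.mk_right_injective i)).injOn
    rintro _ ⟨g, ⟨hg, hC⟩, rfl⟩
    exact ⟨hg, lt_of_lt_of_eq (by linarith) (φ.A_pt i g).symm⟩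
  ⟨⟨fun g => a.1 (φ.pt i g), ha.isPWO⟩, ha⟩

theorem coord_coeff (φ : OrbitBasis L k I) (a : B.chains K) (i : I) (g : G) :
    (φ.coord a i).1.coeff g = a.1 (φ.pt i g) :=
  rfl

theorem chain_coord [Finite I] (φ : OrbitBasis L k I) {a : B.chains K}
    (ha : a ∈ B.chainsDeg K k) : φ.chain (φ.coord a) = a := by
  refine Subtype.ext (funext fun p => ?_)
  by_cases hp : B.gr p = k
  · obtain ⟨i, g, rfl⟩ := φ.exists_pt hp
    rw [φ.chain_pt, φ.coord_coeff]
  · exact (not_not.1 (mt (φ.chain_mem _ p) hp)).trans (not_not.1 (mt (ha p) hp)).symm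

/-- The norms of the basis vectors, for which the weighted supremum of the coordinates of a chain
is the exponential of its level. -/
def weight (φ : OrbitBasis L k I) (i : I) : ℝᵐ⁰ :=
  WithZero.exp (B.A (φ.base i))

theorem weight_ne_zero (φ : OrbitBasis L k I) (i : I) : φ.weight i ≠ 0 :=
  WithZero.exp_ne_zero

theorem level_chain_le_iff [Fintype I] (φ : OrbitBasis L k I) (x : I → novikovField G K) (r : ℝ) :
    B.level (φ.chain x) ≤ r ↔
      weightedSup (novikovValuation G K) φ.weight x ≤ WithZero.exp r := by
  have hcoord (i : I) : φ.weight i * novikovValuation G K (x i) ≤ WithZero.exp r ↔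
      ∀ g : G, (x i).1.coeff g ≠ 0 → B.A (φ.pt i g) ≤ r := by
    rw [weight, ← le_div_iff₀' WithZero.exp_pos, ← WithZero.exp_sub]
    refine orderValuation_le_exp_iff.trans (forall₂_congr fun g _ => ?_)
    rw [φ.A_pt, neg_le_sub_iff_le_add, sub_le_iff_le_add]
  simp only [weightedSup_le_iff, hcoord]
  constructor
  · intro h i g hg
    exact EReal.coe_le_coe_iff.1 ((B.le_level _ (by rwa [φ.chain_pt])).trans h)
  · intro h
    refine B.level_le _ fun p hp => ?_
    obtain ⟨i, g, rfl⟩ := φ.exists_pt (φ.chain_mem _ p hp)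
    rw [φ.chain_pt] at hp
    exact EReal.coe_le_coe_iff.2 (h i g hp)

/-- The same representatives, as a basis for the opposite data. -/
def op (φ : OrbitBasis L k I) : OrbitBasis L.op (-k) I where
  base := φ.base
  gr_base i := congrArg Neg.neg (φ.gr_base i)
  proj_base_injective := φ.proj_base_injective
  exists_proj_base p hp := φ.exists_proj_base p (neg_injective hp)

theorem op_pt (φ : OrbitBasis L k I) (i : I) (g : G) : φ.op.pt i g = φ.pt i (-g) := by
  change B.act (L.lift (Multiplicative.ofAdd g))⁻¹ (φ.base i) = _
  rw [← map_inv, ← ofAdd_neg, pt]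

theorem weight_op (φ : OrbitBasis L k I) : φ.op.weight = φ.weight⁻¹ :=
  funext fun _ => WithZero.exp_neg _

/-- The sum over `P` becomes a convolution at exponent `0` because the opposite basis has its
exponents negated. -/
theorem pairing_chain [Fintype I] (φ : OrbitBasis L k I) (w x : I → novikovField G K) :
    B.pairing (φ.op.chain w) (φ.chain x) = (w ⬝ᵥ x).1.coeff 0 := by
  have hdot : (w ⬝ᵥ x).1 = ∑ i, (x i).1 * (w i).1 := by
    simp only [dotProduct, AddSubmonoidClass.coe_finsetSum, Subfield.coe_mul, mul_comm]
  rw [Base.pairing, φ.finsum_eq (fun p hp => φ.chain_mem x p (right_ne_zero_of_mul hp))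
    (B.pairing_finite (φ.op.chain w).2 (φ.chain x).2), hdot, HahnSeries.coeff_sum]
  refine Finset.sum_congr rfl fun i _ => ?_
  rw [coeff_mul_eq_finsum]
  refine finsum_congr fun g => ?_
  have hpt : φ.pt i g = φ.op.pt i (0 - g) := by rw [φ.op_pt, zero_sub, neg_neg]
  rw [φ.chain_pt, hpt, φ.op.chain_pt, mul_comm]

end OrbitBasis

namespace FloerNovikovComplex

variable [Group.FG Γ] [Finite S] (c : FloerNovikovComplex K Γ P S) {L : PeriodLift c.toBase G}
  {k m : ℤ}

/-- The matrix of the boundary operator over the Novikov field. -/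
noncomputable def bdMatrix (φ : OrbitBasis L k I) (ψ : OrbitBasis L m J) :
    Matrix J I (novikovField G K) :=
  Matrix.of fun j i => ψ.coord (c.bd (c.gen K (φ.pt i 0))) j

theorem bdMatrix_coeff (φ : OrbitBasis L k I) (ψ : OrbitBasis L m J) (i : I) (j : J) (g h : G) :
    (c.bdMatrix φ ψ j i).1.coeff (h - g) = c.n (φ.pt i g) (ψ.pt j h) := by
  have hact := c.n_act (L.lift (Multiplicative.ofAdd g)) (φ.pt i 0) (ψ.pt j (h - g))
  rw [φ.act_pt, ψ.act_pt, add_zero, add_sub_cancel] at hact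
  exact hact.symm

theorem bd_chain [Fintype I] [Finite J] (φ : OrbitBasis L k I) (ψ : OrbitBasis L m J)
    (hk : k = m + 1) (x : I → novikovField G K) :
    c.bd (φ.chain x) = ψ.chain (c.bdMatrix φ ψ *ᵥ x) := by
  have hm : c.bd (φ.chain x) ∈ c.chainsDeg K m := by
    simpa only [hk, add_sub_cancel_right] using c.bd_mem k _ (φ.chain_mem x)
  have hmul (j : J) : ((c.bdMatrix φ ψ *ᵥ x) j).1 = ∑ i, (x i).1 * (c.bdMatrix φ ψ j i).1 := by
    simp only [mulVec, dotProduct, AddSubmonoidClass.coe_finsetSum, Subfield.coe_mul, mul_comm]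
  rw [← ψ.chain_coord hm]
  refine congrArg _ (funext fun j => Subtype.ext (HahnSeries.ext (funext fun h => ?_)))
  rw [ψ.coord_coeff, c.bd_apply, hmul, HahnSeries.coeff_sum,
    φ.finsum_eq (fun p hp => φ.chain_mem x p (left_ne_zero_of_mul hp))
      (((φ.chain x).2.1 (c.A (ψ.pt j h))).subset fun p hp =>
        ⟨left_ne_zero_of_mul hp, c.A_lt_of_n (right_ne_zero_of_mul hp)⟩)]
  refine Finset.sum_congr rfl fun i _ => ?_
  rw [coeff_mul_eq_finsum]
  exact finsum_congr fun g => by rw [c.bdMatrix_coeff, φ.chain_pt]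

theorem opposite_n (p q : P) : c.opposite.n p q = c.n q p := by
  change ∑ᶠ r, (c.gen K p).1 r * c.n q r = _
  rw [finsum_eq_single _ p fun r hr => by rw [not_not.1 (mt c.gen_apply_ne hr), zero_mul],
    c.gen_apply_self, one_mul]

theorem bdMatrix_opposite (φ : OrbitBasis L k I) (ψ : OrbitBasis L m J) :
    c.opposite.bdMatrix ψ.op φ.op = (c.bdMatrix φ ψ)ᵀ := by
  refine Matrix.ext fun i j => Subtype.ext (HahnSeries.ext (funext fun g => ?_))
  have hop := c.opposite.bdMatrix_coeff ψ.op φ.op j i 0 g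
  have h := c.bdMatrix_coeff φ ψ i j (-g) 0
  rw [sub_zero, c.opposite_n, φ.op_pt, ψ.op_pt, neg_zero] at hop
  rw [zero_sub, neg_neg] at h
  rw [transpose_apply, hop, h]

end FloerNovikovComplex

end Coordinates

section BoundaryDepth

open scoped WithZero

variable {K Γ P S I J : Type*} [Field K] [CommGroup Γ]

theorem Base.ne_zero_of_pairing_ne_zero (B : Base Γ P S) {d : B.op.chains K} {a : B.chains K}
    (h : B.pairing d a ≠ 0) : d ≠ 0 ∧ a ≠ 0 := by
  obtain ⟨p, hp⟩ := exists_ne_zero_of_finsum h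
  refine ⟨?_, ?_⟩
  · rintro rfl
    exact hp (zero_mul _)
  · rintro rfl
    exact hp (mul_zero _)

theorem Base.neg_level_op_le (B : Base Γ P S) {d : B.op.chains K} {a : B.chains K}
    (h : B.pairing d a ≠ 0) : -B.op.level d ≤ B.level a := by
  obtain ⟨p, hp⟩ := exists_ne_zero_of_finsum h
  exact (EReal.neg_le.2 (B.op.le_level d (left_ne_zero_of_mul hp))).trans
    (B.le_level a (right_ne_zero_of_mul hp))

namespace FloerNovikovComplex

variable [Group.FG Γ] [Finite S] (c : FloerNovikovComplex K Γ P S)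
  {G : AddSubgroup ℝ} {L : PeriodLift c.toBase G} {k m : ℤ}

theorem boundaries_le_chainsDeg : c.boundaries (m + 1) ≤ c.chainsDeg K m := by
  rintro _ ⟨a, ha, rfl⟩
  simpa only [add_sub_cancel_right] using c.bd_mem _ a ha

theorem boundaryDepth_nonneg (m : ℤ) : 0 ≤ c.boundaryDepth m := by
  refine le_sInf ?_
  rintro _ ⟨b, ⟨hb, -⟩, rfl⟩
  exact EReal.coe_nonneg.2 hb

theorem boundaryDepth_le [Fintype I] [Fintype J] (φ : OrbitBasis L k I) (ψ : OrbitBasis L m J)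
    (hk : k = m + 1) {b : ℝ} (hb : 0 ≤ b)
    (h : BoundedLift (novikovValuation G K) φ.weight ψ.weight (c.bdMatrix φ ψ) (WithZero.exp b)) :
    c.boundaryDepth m ≤ b := by
  refine sInf_le ⟨b, ⟨hb, ?_⟩, rfl⟩
  rintro γ _ ⟨⟨a, ha, rfl⟩, -, hγ⟩
  obtain ⟨r, hr, hrγ⟩ := EReal.lt_iff_exists_real_btwn.1 hγ
  have ha_bd : c.bd a = ψ.chain (c.bdMatrix φ ψ *ᵥ φ.coord a) := by
    rw [← c.bd_chain φ ψ hk, φ.chain_coord (hk ▸ ha)]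
  obtain ⟨x, hx, hle⟩ := h (φ.coord a)
  refine ⟨φ.chain x, ⟨hk ▸ φ.chain_mem x, ?_⟩, by rw [c.bd_chain φ ψ hk, hx, ha_bd]⟩
  calc c.level (φ.chain x) ≤ ((b + r : ℝ) : EReal) := by
        rw [φ.level_chain_le_iff, WithZero.exp_add]
        refine hle.trans (mul_le_mul_right ((ψ.level_chain_le_iff _ r).1 ?_) _)
        rw [← ha_bd]
        exact hr.le
    _ < ((γ + b : ℝ) : EReal) := by
        rw [EReal.coe_lt_coe_iff] at hrγ ⊢
        linarith

theorem sub_le_boundaryDepth {y : c.chains K} (hy : y ∈ c.boundaries (m + 1)) {u s : ℝ}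
    (hu : c.level y = u) (hs : ∀ a, c.bd a = y → (s : EReal) ≤ c.level a) :
    ((s - u : ℝ) : EReal) ≤ c.boundaryDepth m := by
  refine le_sInf ?_
  rintro _ ⟨b, ⟨-, hb⟩, rfl⟩
  rw [EReal.coe_le_coe_iff]
  by_contra! hlt
  have hγ : c.level y < ((s - b : ℝ) : EReal) := by
    rw [hu, EReal.coe_lt_coe_iff]
    linarith
  obtain ⟨a, ⟨-, ha⟩, hay⟩ := hb (s - b) ⟨hy, c.boundaries_le_chainsDeg hy, hγ⟩
  rw [sub_add_cancel] at ha
  exact (hs a hay).not_gt ha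

/-- The values `ℓ(y) + ℓᵒᵖ(x)` over the pairs of boundaries with nonzero linking form. -/
def linkingLevels (k : ℤ) : Set EReal :=
  {r | ∃ (x : c.opposite.boundaries (-k + 1)) (y : c.boundaries k),
    c.linkingForm k x y ≠ 0 ∧ r = c.level y.1 + c.opposite.level x.1}

variable {c} in
/-- Any primitive of `y` pairs nontrivially with `x`, and any primitive of `x` with `y`. -/
theorem neg_le_boundaryDepth_of_mem_linkingLevels {r : EReal} (hr : r ∈ c.linkingLevels k) :
    -r ≤ c.boundaryDepth (k - 1) ∧ -r ≤ c.opposite.boundaryDepth (-k) := by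
  obtain ⟨x, y, hxy, rfl⟩ := hr
  have hx (a) (ha : c.bd a = y.1) : c.pairing x.1 a ≠ 0 := c.linkingForm_eq k x y a ha ▸ hxy
  have hy (d) (hd : c.opposite.bd d = x.1) : c.pairing d y.1 ≠ 0 := by
    obtain ⟨a, -, ha⟩ := y.2
    rw [← ha, ← c.pairing_opBd]
    exact hd ▸ hx a ha
  obtain ⟨d, -, hd⟩ := x.2
  obtain ⟨a, -, ha⟩ := y.2
  obtain ⟨p, -, hp⟩ := c.exists_level_eq y.1 (c.ne_zero_of_pairing_ne_zero (hy d hd)).2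
  obtain ⟨q, -, hq⟩ := c.op.exists_level_eq x.1 (c.ne_zero_of_pairing_ne_zero (hx a ha)).1
  have hr : -(c.level y.1 + c.opposite.level x.1) = ((-c.op.A q - c.A p : ℝ) : EReal) := by
    rw [hp, hq, ← EReal.coe_add, ← EReal.coe_neg, neg_add']
    ring_nf
  rw [hr]
  refine ⟨c.sub_le_boundaryDepth (by rw [sub_add_cancel]; exact y.2) hp fun a ha => ?_, ?_⟩
  · rw [EReal.coe_neg, ← hq]
    exact c.neg_level_op_le (hx a ha)
  · rw [neg_sub_comm]
    refine c.opposite.sub_le_boundaryDepth x.2 hq fun d hd => ?_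
    rw [EReal.coe_neg, ← hp]
    exact EReal.neg_le.1 (c.neg_level_op_le (hy d hd))

theorem neg_sInf_linkingLevels_le {D : EReal} (hD : 0 ≤ D) (h : ∀ r ∈ c.linkingLevels k, -r ≤ D) :
    -sInf ({0} ∪ c.linkingLevels k) ≤ D := by
  rw [EReal.neg_le]
  refine le_sInf ?_
  rintro r (rfl | hr)
  · exact EReal.neg_le_zero.2 hD
  · exact EReal.neg_le.1 (h r hr)

theorem add_level_mem_linkingLevels {a : c.chains K} {d : c.op.chains K}
    (ha : a ∈ c.chainsDeg K k) (hd : d ∈ c.opposite.chainsDeg K (-k + 1))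
    (h : c.pairing d (c.bd a) ≠ 0) :
    c.level (c.bd a) + c.op.level (c.opBd d) ∈ c.linkingLevels k := by
  refine ⟨⟨_, _, hd, rfl⟩, ⟨_, _, ha, rfl⟩, ?_, rfl⟩
  rw [c.linkingForm_eq k _ _ a rfl]
  exact (c.pairing_opBd d a).trans_ne h

theorem exists_linkingLevel_le [Fintype I] [Fintype J] (φ : OrbitBasis L k I)
    (ψ : OrbitBasis L m J) (hk : k = m + 1) {b : ℝ}
    (h : DualWitness (novikovValuation G K) φ.weight ψ.weight (c.bdMatrix φ ψ) (WithZero.exp b)) :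
    ∃ r ∈ c.linkingLevels k, r ≤ ((-b : ℝ) : EReal) := by
  obtain ⟨x, w, hwx, hle⟩ := h
  set M := c.bdMatrix φ ψ
  have hxw : x ⬝ᵥ Mᵀ *ᵥ w = 1 := by
    rw [mulVec_transpose, dotProduct_comm, ← dotProduct_mulVec, hwx]
  have hMx := weightedSup_ne_zero_of_dotProduct_eq_one (v := novikovValuation G K)
    ψ.weight_ne_zero hwx
  have hMw := weightedSup_ne_zero_of_dotProduct_eq_one (v := novikovValuation G K)
    φ.op.weight_ne_zero hxw
  rw [← φ.weight_op, ← WithZero.exp_log hMx, ← WithZero.exp_log hMw, ← WithZero.exp_add,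
    ← WithZero.exp_add, ← WithZero.exp_zero, WithZero.exp_le_exp] at hle
  have hbd : c.bd (φ.chain x) = ψ.chain (M *ᵥ x) := c.bd_chain φ ψ hk x
  have hopBd : c.opBd (ψ.op.chain w) = φ.op.chain (Mᵀ *ᵥ w) := by
    rw [← c.bdMatrix_opposite]
    exact c.opposite.bd_chain ψ.op φ.op (by omega) w
  have hw : ψ.op.chain w ∈ c.opposite.chainsDeg K (-k + 1) := by
    rw [show -k + 1 = -m by omega]
    exact ψ.op.chain_mem w
  have hpair : c.pairing (ψ.op.chain w) (c.bd (φ.chain x)) ≠ 0 := by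
    rw [hbd, ψ.pairing_chain, hwx, Subfield.coe_one, HahnSeries.coeff_one, if_pos rfl]
    exact one_ne_zero
  refine ⟨_, c.add_level_mem_linkingLevels (φ.chain_mem x) hw hpair, ?_⟩
  rw [hbd, hopBd]
  refine (add_le_add ((ψ.level_chain_le_iff _ _).2 (WithZero.exp_log hMx).ge)
    ((φ.op.level_chain_le_iff _ _).2 (WithZero.exp_log hMw).ge)).trans ?_
  rw [← EReal.coe_add, EReal.coe_le_coe_iff]
  linarith

theorem exists_boundaryDepth_le (hinj : Set.InjOn c.ω (c.deg.ker : Set Γ)) (k : ℤ) :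
    ∃ b : ℝ, c.boundaryDepth (k - 1) ≤ b ∧ c.opposite.boundaryDepth (-k) ≤ b ∧
      (b : EReal) ≤ -sInf ({0} ∪ c.linkingLevels k) := by
  obtain ⟨G, ⟨L⟩⟩ := exists_periodLift c.toBase hinj
  obtain ⟨φ⟩ := exists_orbitBasis L k
  obtain ⟨ψ⟩ := exists_orbitBasis L (k - 1)
  have (j : ℤ) : Fintype {s : S // ∃ p, c.proj p = s ∧ c.gr p = j} := Fintype.ofFinite _
  obtain ⟨B, hlift, hliftT, hB⟩ := exists_boundedLift_and_transpose (v := novikovValuation G K)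
    φ.weight_ne_zero ψ.weight_ne_zero (c.bdMatrix φ ψ)
  rw [← φ.weight_op, ← ψ.weight_op, ← c.bdMatrix_opposite] at hliftT
  have hdepth {b : ℝ} (hb : 0 ≤ b) (hBb : B ≤ WithZero.exp b) :
      c.boundaryDepth (k - 1) ≤ b ∧ c.opposite.boundaryDepth (-k) ≤ b :=
    ⟨c.boundaryDepth_le φ ψ (by omega) hb (hlift.mono hBb),
      c.opposite.boundaryDepth_le ψ.op φ.op (by omega) hb (hliftT.mono hBb)⟩
  rcases le_or_gt B 1 with hB₁ | hB₁
  · obtain ⟨h, hop⟩ := hdepth le_rfl (hB₁.trans_eq WithZero.exp_zero.symm)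
    refine ⟨0, h, hop, EReal.le_neg.2 ?_⟩
    rw [EReal.coe_zero, _root_.neg_zero]
    exact sInf_le (Set.mem_union_left _ rfl)
  · have hB₀ : B ≠ 0 := (zero_lt_one.trans hB₁).ne'
    obtain ⟨b, rfl⟩ : ∃ b, WithZero.exp b = B := ⟨_, WithZero.exp_log hB₀⟩
    rw [← WithZero.exp_zero, WithZero.exp_lt_exp] at hB₁
    obtain ⟨h, hop⟩ := hdepth hB₁.le le_rfl
    obtain ⟨r, hr, hrb⟩ := c.exists_linkingLevel_le φ ψ (by omega) (hB.resolve_left hB₀)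
    exact ⟨b, h, hop, EReal.le_neg.2 ((sInf_le (Set.mem_union_right _ hr)).trans hrb)⟩

end FloerNovikovComplex

end BoundaryDepth

end FloerNovikov

theorem mainTheorem3 {K Γ P S : Type*} [Field K] [CommGroup Γ] [Group.FG Γ] [Finite S]
    (c : FloerNovikov.FloerNovikovComplex K Γ P S)
    (hinj : Set.InjOn c.ω (c.deg.ker : Set Γ)) (k : ℤ) :
    c.boundaryDepth (k - 1) = c.opposite.boundaryDepth (-k) ∧
    c.opposite.boundaryDepth (-k) =
      -sInf ({0} ∪ {r : EReal | ∃ (x : c.opposite.boundaries (-k + 1)) (y : c.boundaries k),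
        c.linkingForm k x y ≠ 0 ∧ r = c.level y.1 + c.opposite.level x.1}) ∧
    c.boundaryDepth (k - 1) ≠ ⊤ := by
  change _ ∧ _ = -sInf ({0} ∪ c.linkingLevels k) ∧ _
  obtain ⟨b, hb, hb_op, hb_le⟩ := c.exists_boundaryDepth_le hinj k
  have h_le := c.neg_sInf_linkingLevels_le (c.boundaryDepth_nonneg (k - 1)) fun _ hr =>
    (FloerNovikov.FloerNovikovComplex.neg_le_boundaryDepth_of_mem_linkingLevels hr).1
  have h_op_le := c.neg_sInf_linkingLevels_le (c.opposite.boundaryDepth_nonneg (-k)) fun _ hr =>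
    (FloerNovikov.FloerNovikovComplex.neg_le_boundaryDepth_of_mem_linkingLevels hr).2
  have h_eq := le_antisymm (hb.trans hb_le) h_le
  have h_op_eq := le_antisymm (hb_op.trans hb_le) h_op_le
  exact ⟨h_eq.trans h_op_eq.symm, h_op_eq, ne_top_of_le_ne_top (EReal.coe_ne_top b) hb⟩
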